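/- Let $n$ participants be given, participant $i$ having the linear Gaussian model $x_{i,t+1}=A_ix_{i,t}+B_iw_{i,t}$, $y_{i,t}=C_ix_{i,t}+D_iw_{i,t}$ ($t\ge 0$), where each $w_i$ is a standard white Gaussian noise, $x_{i,0}$ has mean $\bar x_{i,0}$, $D_i$ has full row rank, $B_iD_i^T=0$, $(A_i,C_i)$ is detectable and $(A_i,B_i)$ is stabilizable. Let $L_i$ be matrices with $q$ rows. Let $\mathcal K_i$ be the steady-state Kalman filter of system $i$: with $V_i$ the positive semidefinite solution of $$V=A_iVA_i^T-A_iVC_i^T(C_iVC_i^T+D_iD_i^T)^{-1}C_iVA_i^T+B_iB_i^T$$ and $M_i=V_iC_i^T(C_iV_iC_i^T+D_iD_i^T)^{-1}$, it maps $y_i$ to the estimates $(\mathcal K_iy_i)_t=\hat x_{i,t}+M_i(y_{i,t}-C_i\hat x_{i,t})$, where $\hat x_{i,0}=\bar x_{i,0}$ and $\hat x_{i,t+1}=A_i(\mathcal K_iy_i)_t$. For each $i$ let $T_i$ be the diagonal $0$-$1$ matrix selecting a set $\mathcal S_i$ of coordinates of the state of participant $i$, and let $\rho_i\ge 0$. The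 datasets are the global state trajectories $x=(x_1,\dots,x_n)$, where each $x_i$ is an arbitrary sequence of states of participant $i$. Two of them, $x$ and $x'$, are adjacent if for some $i$ one has $\|T_ix_i-T_ix_i'\|_{\ell_2}\le\rho_i$, $(I-T_i)x_i=(I-T_i)x_i'$, and $x_j=x'_j$ for all $j\ne i$. Let $\epsilon>0$, $0<\delta<1$ and $\kappa(\delta,\epsilon)=\frac1{2\epsilon}\bigl(K+\sqrt{K^2+2\epsilon}\bigr)$, where $K=\mathcal Q^{-1}(\delta)$ and $\mathcal Q(x)=\frac1{\sqrt{2\pi}}\int_x^\infty e^{-u^2/2}\,du$. Let $\gamma=\max_i\gamma_i\rho_i$, where $\gamma_i$ is the $\mathcal H_\infty$ norm $\operatorname{ess\,sup}_{\theta\in[-\pi,\pi)}\sigma_{\max}(G_i(e^{\mathrm{i}\theta}))$ of the transfer function $G_i$ of $L_i\mathcal K_iC_iT_i$. Let $\nu$ be a standard white Gaussian noise in $\mathbb R^q$ independent of $\{w_i\}_{1\le i\le n}$. Then each filter $\mathcal K_i$ is well defined and stable (the above equation has exactly one positive semidefinite solution and all eigenvalues of $A_i-A_iM_iC_i$ have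 modulus less than $1$), each $\gamma_i$ is finite, and the mechanism which to the dataset $x$ associates the released signal $$\sum_{i=1}^nL_i\mathcal K_iy_i+\gamma\,\kappa(\delta,\epsilon)\,\nu,\qquad y_{i,t}=C_ix_{i,t}+D_iw_{i,t},$$ is $(\epsilon,\delta)$-differentially private: if $M(x)$ denotes the released signal, a random element of $(\mathbb R^q)^{\mathbb N}$ with its product $\sigma$-algebra, then for all adjacent $x,x'$ there is a positive measure $\mu$ on $(\mathbb R^q)^{\mathbb N}$ of total mass at most $\delta$ such that $\mathbb P(M(x)\in S)\le e^{\epsilon}\,\mathbb P(M(x')\in S)+\mu(S)$ for all measurable $S$. (Equivalently, $\mathbb P(M(x)\in S)\le e^{\epsilon}\,\mathbb P(M(x')\in S)+\delta$ for all adjacent $x,x'$ and all measurable $S$.) -/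

import Mathlib

open MeasureTheory ProbabilityTheory
open scoped ENNReal Matrix

noncomputable section

namespace PrivateKalman

/-! ### Differential privacy -/

/-- `M : D → Ω → R` is a mechanism (each `M d` is a random variable) which is `(ε, δ)`-differentially
private for the adjacency relation `Adj`: for adjacent `d, d'` there is a positive measure `μ` on `R`
with `μ(R) ≤ δ` and `Pr(M d ∈ S) ≤ e^ε Pr(M d' ∈ S) + μ(S)` for every measurable `S`. -/
def IsDifferentiallyPrivate {D Ω R : Type*} [MeasurableSpace Ω] [MeasurableSpace R]
    (Adj : D → D → Prop) (Pr : Measure Ω) (ε δ : ℝ) (M : D → Ω → R) : Prop :=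
  (∀ d, Measurable (M d)) ∧
  ∀ d d', Adj d d' → ∃ μ : Measure R, μ Set.univ ≤ ENNReal.ofReal δ ∧
    ∀ S : Set R, MeasurableSet S →
      Pr {ω | M d ω ∈ S} ≤ ENNReal.ofReal (Real.exp ε) * Pr {ω | M d' ω ∈ S} + μ S

/-- The Gaussian tail `𝒬(x) = (2π)^{-1/2} ∫_x^∞ e^{-u²/2} du`. -/
def qFunction (x : ℝ) : ℝ :=
  1 / Real.sqrt (2 * Real.pi) * ∫ u in Set.Ioi x, Real.exp (-u ^ 2 / 2)

/-- `κ(δ, ε) = (K + √(K² + 2ε)) / (2ε)` with `K = 𝒬⁻¹(δ)`, for `0 < δ < 1` and `0 < ε`. -/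
def kappa (δ ε : ℝ) : ℝ :=
  1 / (2 * ε) * (Function.invFun qFunction δ +
    Real.sqrt (Function.invFun qFunction δ ^ 2 + 2 * ε))

/-! ### Signals and noise -/

/-- The `ℓ₂` norm (possibly `∞`) of a discrete-time vector signal. -/
def l2Norm {k : ℕ} (u : ℕ → Fin k → ℝ) : ℝ≥0∞ :=
  (∑' t, ∑ j, ‖u t j‖ₑ ^ 2) ^ (1 / 2 : ℝ)

/-- Standard white Gaussian noise in `ℝᵏ`: all the scalar variables `ν t · j` are independent
and standard normal. -/
def IsStandardWhiteNoise {Ω : Type*} [MeasurableSpace Ω] (Pr : Measure Ω) {k : ℕ}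
    (ν : ℕ → Ω → Fin k → ℝ) : Prop :=
  (∀ t, Measurable (ν t)) ∧
  (∀ t j, Pr.map (fun ω => ν t ω j) = gaussianReal 0 1) ∧
  iIndepFun (fun (s : ℕ × Fin k) (ω : Ω) => ν s.1 ω s.2) Pr

/-! ### Linear systems -/

/-- Entrywise complexification of a real matrix. -/
def toComplex {k l : ℕ} (M : Matrix (Fin k) (Fin l) ℝ) : Matrix (Fin k) (Fin l) ℂ :=
  M.map (fun r : ℝ => (r : ℂ))

/-- Discrete-time (Schur) stability: all complex eigenvalues lie in the open unit disc. -/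
def IsSchur {k : ℕ} (A : Matrix (Fin k) (Fin k) ℝ) : Prop :=
  ∀ z ∈ spectrum ℂ (toComplex A), ‖z‖ < 1

/-- The transfer function `H (zI - F)⁻¹ G + J` of `ξ⁺ = F ξ + G u`, `v = H ξ + J u`. -/
def transferFunction {k l q : ℕ} (F : Matrix (Fin k) (Fin k) ℝ) (G : Matrix (Fin k) (Fin l) ℝ)
    (H : Matrix (Fin q) (Fin k) ℝ) (J : Matrix (Fin q) (Fin l) ℝ) (z : ℂ) :
    Matrix (Fin q) (Fin l) ℂ :=
  toComplex H * (z • (1 : Matrix (Fin k) (Fin k) ℂ) - toComplex F)⁻¹ * toComplex G + toComplex J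

/-- The largest singular value, i.e. the operator norm for the Euclidean norms. -/
def sigmaMax {q l : ℕ} (M : Matrix (Fin q) (Fin l) ℂ) : ℝ :=
  ‖(Matrix.toEuclideanLin M).toContinuousLinearMap‖

/-- The `H_∞` norm of a (stable) transfer function:
`ess sup_{θ ∈ [-π, π)} σ_max (𝒢(e^{iθ}))`. -/
def hInfNorm {q l : ℕ} (G : ℂ → Matrix (Fin q) (Fin l) ℂ) : ℝ≥0∞ :=
  essSup (fun θ : ℝ => ENNReal.ofReal (sigmaMax (G (Complex.exp (θ * Complex.I)))))
    (volume.restrict (Set.Ico (-Real.pi) Real.pi))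

/-- The public data of one participant: the model `x⁺ = A x + B w`, `y = C x + D w`, the mean
`xbar` of the initial state, and the matrix `L` of its contribution `L x ∈ ℝ^q` to the quantity
being estimated. -/
structure Participant (q : ℕ) where
  (d m p : ℕ)
  A : Matrix (Fin d) (Fin d) ℝ
  B : Matrix (Fin d) (Fin m) ℝ
  C : Matrix (Fin p) (Fin d) ℝ
  D : Matrix (Fin p) (Fin m) ℝ
  L : Matrix (Fin q) (Fin d) ℝ
  xbar : Fin d → ℝ

namespace Participant

variable {q : ℕ} (P : Participant q)

/-- `(A, C)` is detectable. -/
def Detectable : Prop := ∃ G : Matrix (Fin P.d) (Fin P.p) ℝ, IsSchur (P.A - G * P.C)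

/-- `(A, B)` is stabilizable. -/
def Stabilizable : Prop := ∃ K : Matrix (Fin P.m) (Fin P.d) ℝ, IsSchur (P.A - P.B * K)

/-- The covariance `C V Cᵀ + D Dᵀ` of the innovations when the prediction error has covariance
`V`. -/
def innovationCov (V : Matrix (Fin P.d) (Fin P.d) ℝ) : Matrix (Fin P.p) (Fin P.p) ℝ :=
  P.C * V * P.Cᵀ + P.D * P.Dᵀ

/-- `V` is a steady-state prediction error covariance: a positive semidefinite solution of the
filtering algebraic Riccati equation (for uncorrelated process and measurement noises). -/
def IsSteadyStateCov (V : Matrix (Fin P.d) (Fin P.d) ℝ) : Prop :=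
  V.PosSemidef ∧
  V = P.A * V * P.Aᵀ
      - P.A * V * P.Cᵀ * (P.innovationCov V)⁻¹ * P.C * V * P.Aᵀ
      + P.B * P.Bᵀ

open Classical in
/-- The steady-state prediction error covariance (the value `0` is used only if there is none). -/
def steadyStateCov : Matrix (Fin P.d) (Fin P.d) ℝ :=
  if h : ∃ V, P.IsSteadyStateCov V then h.choose else 0

/-- The steady-state Kalman gain `V Cᵀ (C V Cᵀ + D Dᵀ)⁻¹`. -/
def gain : Matrix (Fin P.d) (Fin P.p) ℝ :=
  P.steadyStateCov * P.Cᵀ * (P.innovationCov P.steadyStateCov)⁻¹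

/-- The one-step predictions `x̂_{t|t-1}` of the steady-state Kalman filter driven by `y`, started
at the mean of the initial state. -/
def prediction (y : ℕ → Fin P.p → ℝ) : ℕ → Fin P.d → ℝ
  | 0 => P.xbar
  | t + 1 => P.A *ᵥ (prediction y t + P.gain *ᵥ (y t - P.C *ᵥ prediction y t))

/-- The steady-state Kalman filter `𝒦`, which maps `y` to the estimates
`x̂_{t|t} = x̂_{t|t-1} + gain (y_t - C x̂_{t|t-1})`. -/
def kalmanFilter (y : ℕ → Fin P.p → ℝ) (t : ℕ) : Fin P.d → ℝ :=
  P.prediction y t + P.gain *ᵥ (y t - P.C *ᵥ P.prediction y t)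

/-- The state matrix `A - A gain C` of the Kalman filter. -/
def filterMatrix : Matrix (Fin P.d) (Fin P.d) ℝ := P.A - P.A * P.gain * P.C

/-- The diagonal 0-1 matrix `T` selecting the coordinates in `S`. -/
def selection (S : Finset (Fin P.d)) : Matrix (Fin P.d) (Fin P.d) ℝ :=
  Matrix.diagonal (fun j => if j ∈ S then 1 else 0)

/-- The transfer function of `L 𝒦 C T`, from the realization
`x̂⁺ = (A - A gain C) x̂ + A gain (C T u)`, `v = L ((I - gain C) x̂ + gain (C T u))`. -/
def filterTransfer (S : Finset (Fin P.d)) : ℂ → Matrix (Fin q) (Fin P.d) ℂ :=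
  transferFunction P.filterMatrix
    (P.A * P.gain * (P.C * P.selection S))
    (P.L * (1 - P.gain * P.C))
    (P.L * P.gain * (P.C * P.selection S))

end Participant

/-! ### The output perturbation mechanism -/

/-- The datasets: a state trajectory for each participant. -/
abbrev Trajectories {n q : ℕ} (P : Fin n → Participant q) : Type :=
  (i : Fin n) → ℕ → Fin (P i).d → ℝ

/-- Adjacency of global state trajectories: they differ only in the selected coordinates of a single
participant `i`, by at most `ρ i` in `ℓ₂` norm. -/
def Adjacent {n q : ℕ} (P : Fin n → Participant q) (S : (i : Fin n) → Finset (Fin (P i).d))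
    (ρ : Fin n → ℝ) (x x' : Trajectories P) : Prop :=
  ∃ i,
    l2Norm (fun t => (P i).selection (S i) *ᵥ x i t - (P i).selection (S i) *ᵥ x' i t)
      ≤ ENNReal.ofReal (ρ i) ∧
    (∀ t, (1 - (P i).selection (S i)) *ᵥ x i t = (1 - (P i).selection (S i)) *ᵥ x' i t) ∧
    ∀ j, j ≠ i → x j = x' j

/-- `γ = max_i γ_i ρ_i`, with `γ_i` the `H_∞` norm of `L_i 𝒦_i C_i T_i`. -/
def noiseGain {n q : ℕ} (P : Fin n → Participant q) (S : (i : Fin n) → Finset (Fin (P i).d))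
    (ρ : Fin n → ℝ) : ℝ :=
  ⨆ i, (hInfNorm ((P i).filterTransfer (S i))).toReal * ρ i

/-- The released signal `∑ i, L_i 𝒦_i y_i + c ν`, where `y_i = C_i x_i + D_i w_i`. -/
def outputPerturbation {n q : ℕ} {Ω : Type*} (P : Fin n → Participant q)
    (w : (i : Fin n) → ℕ → Ω → Fin (P i).m → ℝ) (c : ℝ) (ν : ℕ → Ω → Fin q → ℝ)
    (x : Trajectories P) (ω : Ω) : ℕ → Fin q → ℝ :=
  fun t =>
    ∑ i, (P i).L *ᵥ (P i).kalmanFilter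
        (fun s => (P i).C *ᵥ x i s + (P i).D *ᵥ w i s ω) t
      + c • ν t ω

end PrivateKalman

end

namespace PrivateKalman

open Filter Topology

/-! ### Gaussian measures -/

/-! Fix adjacent datasets that differ at participant `i`. The filter is affine and the measurement
noises are common to both, so the two releases differ by a deterministic signal `v`: the output of
the stable system `L_i 𝒦_i C_i T_i`, started at zero and driven by the difference of the
trajectories. The `ℓ₂` gain of this system is at most its `H_∞` norm (`sum_sq_systemOutput_le`), so
`v` has norm at most `γ_i ρ_i ≤ γ`.

Given the measurement noises, privacy thus compares white noise with white noise shifted by `b = v /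
(γ κ)`, of norm `r ≤ 1/κ`. The density of the shifted law is `exp(⟨b, x⟩ - r²/2)`. It exceeds `e^ε`
exactly when `⟨b, x⟩ > ε + r²/2`, an event of shifted probability `𝒬(ε/r - r/2)`, and `κ` is chosen
so that this equals `δ` at `r = 1/κ`. This is `pi_gaussianReal_le`. Approximation by cylinders
extends it to infinite sequences, Fubini restores the measurement noises (`measure_shift_le`), and a
Hahn decomposition turns the additive `δ` into a measure (`exists_measure_of_le_add`).

The gain bound is Parseval's identity on a finite horizon, with a boundary term that vanishes as the
horizon grows.

For the Riccati equation, iteration from `0` is monotone and, by detectability, bounded by the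
covariances of a fixed stabilizing gain, so it converges to a solution. If the closed loop of a
solution had an eigenvalue of modulus at least `1`, its left eigenvector would annihilate both the
gain and `B`, contradicting stabilizability. The difference of two solutions satisfies `X = F X Hᵀ`
with `F`, `H` stable, hence vanishes. -/

lemma map_sum_gaussianReal {Ω ι : Type*} [MeasurableSpace Ω] {Pr : Measure Ω}
    [IsProbabilityMeasure Pr] {X : ι → Ω → ℝ} {m : ι → ℝ} {v : ι → NNReal}
    (hX : ∀ i, Measurable (X i)) (hind : iIndepFun X Pr)
    (hlaw : ∀ i, Pr.map (X i) = gaussianReal (m i) (v i)) (s : Finset ι) :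
    Pr.map (∑ i ∈ s, X i) = gaussianReal (∑ i ∈ s, m i) (∑ i ∈ s, v i) := by
  classical
  induction s using Finset.induction_on with
  | empty =>
    have h : (0 : Ω → ℝ) = fun _ => 0 := rfl
    simp [h, Measure.map_const]
  | insert i s hi ih =>
    rw [Finset.sum_insert hi, Finset.sum_insert hi, Finset.sum_insert hi]
    exact gaussianReal_add_gaussianReal_of_indepFun
      (hind.indepFun_finsetSum_of_notMem hX hi).symm (hlaw i) ih

lemma gaussianReal_eq_withDensity (m : ℝ) :
    gaussianReal m 1 = (gaussianReal 0 1).withDensity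
      (fun x => ENNReal.ofReal (Real.exp (m * x - m ^ 2 / 2))) := by
  rw [gaussianReal_of_var_ne_zero _ one_ne_zero, gaussianReal_of_var_ne_zero _ one_ne_zero,
    ← withDensity_mul _ (measurable_gaussianPDF 0 1) (by fun_prop)]
  congr 1
  ext x
  rw [Pi.mul_apply, gaussianPDF, gaussianPDF,
    ← ENNReal.ofReal_mul (gaussianPDFReal_nonneg _ _ _), gaussianPDFReal, gaussianPDFReal,
    mul_assoc (Real.sqrt _)⁻¹, ← Real.exp_add]
  congr 3
  push_cast
  ring

lemma pi_withDensity {ι : Type*} [Fintype ι] {X : ι → Type*} [∀ i, MeasurableSpace (X i)]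
    (μ : (i : ι) → Measure (X i)) [∀ i, IsProbabilityMeasure (μ i)] (f : (i : ι) → X i → ℝ≥0∞)
    (hf : ∀ i, Measurable (f i)) [∀ i, SigmaFinite ((μ i).withDensity (f i))] :
    Measure.pi (fun i => (μ i).withDensity (f i)) =
      (Measure.pi μ).withDensity (fun x => ∏ i, f i (x i)) := by
  refine (Measure.pi_eq fun s hs => ?_)
  have hind : iIndepFun (fun i (x : (i : ι) → X i) => (s i).indicator (f i) (x i))
      (Measure.pi μ) :=
    iIndepFun_pi fun i => ((hf i).indicator (hs i)).aemeasurable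
  have key := lintegral_prod_eq_prod_lintegral_of_indepFun Finset.univ _ hind
    (fun i => ((hf i).indicator (hs i)).comp (measurable_pi_apply i))
  rw [withDensity_apply _ (MeasurableSet.univ_pi hs),
    ← lintegral_indicator (MeasurableSet.univ_pi hs)]
  calc ∫⁻ x, (Set.univ.pi s).indicator (fun x => ∏ i, f i (x i)) x ∂Measure.pi μ
      = ∫⁻ x, ∏ i, (s i).indicator (f i) (x i) ∂Measure.pi μ := by
        congr 1
        ext x
        by_cases hx : x ∈ Set.univ.pi s
        · rw [Set.indicator_of_mem hx]
          exact Finset.prod_congr rfl fun i _ => (Set.indicator_of_mem (hx i trivial) _).symm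
        · rw [Set.indicator_of_notMem hx]
          simp only [Set.mem_univ_pi, not_forall] at hx
          obtain ⟨i, hi⟩ := hx
          exact (Finset.prod_eq_zero (Finset.mem_univ i) (Set.indicator_of_notMem hi _)).symm
    _ = ∏ i, (μ i).withDensity (f i) (s i) := by
        rw [key]
        refine Finset.prod_congr rfl fun i _ => ?_
        rw [withDensity_apply _ (hs i), ← lintegral_indicator (hs i),
          ← (measurePreserving_eval μ i).lintegral_comp ((hf i).indicator (hs i))]

/-- The density depends on `x` only through the scalar `∑ i, m i * x i`, which reduces the privacy
loss to a one-dimensional Gaussian. -/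
lemma pi_gaussianReal_eq_withDensity {ι : Type*} [Fintype ι] (m : ι → ℝ) :
    Measure.pi (fun i => gaussianReal (m i) 1) =
      (Measure.pi fun _ : ι => gaussianReal 0 1).withDensity
        (fun x => ENNReal.ofReal (Real.exp (∑ i, m i * x i - (∑ i, m i ^ 2) / 2))) := by
  have : ∀ i, SigmaFinite ((gaussianReal 0 1).withDensity
      (fun x => ENNReal.ofReal (Real.exp (m i * x - m i ^ 2 / 2)))) := fun i => by
    rw [← gaussianReal_eq_withDensity]; infer_instance
  calc Measure.pi (fun i => gaussianReal (m i) 1)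
      = Measure.pi (fun i => (gaussianReal 0 1).withDensity
          (fun x => ENNReal.ofReal (Real.exp (m i * x - m i ^ 2 / 2)))) := by
        congr 1; ext1 i; exact gaussianReal_eq_withDensity _
    _ = _ := by
        rw [pi_withDensity _ _ (fun i => by fun_prop)]
        congr 1
        ext x
        rw [← ENNReal.ofReal_prod_of_nonneg (fun i _ => (Real.exp_pos _).le), ← Real.exp_sum,
          Finset.sum_sub_distrib, Finset.sum_div]

/-! ### The Gaussian tail -/

lemma gaussianReal_Ioi (x : ℝ) : gaussianReal 0 1 (Set.Ioi x) = ENNReal.ofReal (qFunction x) := by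
  rw [gaussianReal_apply_eq_integral _ one_ne_zero, qFunction, ← integral_const_mul]
  congr 2
  ext u
  simp [gaussianPDFReal]

lemma qFunction_eq_one_sub_cdf (x : ℝ) : qFunction x = 1 - cdf (gaussianReal 0 1) x := by
  have h := prob_compl_eq_one_sub (μ := gaussianReal 0 1) (measurableSet_Iic (a := x))
  rw [Set.compl_Iic, gaussianReal_Ioi, ← ofReal_cdf, ← ENNReal.ofReal_one,
    ← ENNReal.ofReal_sub _ (cdf_nonneg _ _)] at h
  refine (ENNReal.ofReal_eq_ofReal_iff ?_ (sub_nonneg.2 (cdf_le_one _ _))).1 h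
  rw [qFunction]
  exact mul_nonneg (by positivity) (integral_nonneg fun u => (Real.exp_pos _).le)

lemma antitone_qFunction : Antitone qFunction := fun x y h => by
  rw [qFunction_eq_one_sub_cdf, qFunction_eq_one_sub_cdf]
  exact sub_le_sub_left (monotone_cdf _ h) _

lemma continuous_cdf_gaussianReal : Continuous (cdf (gaussianReal 0 1)) := by
  have := nullSingletonClass_gaussianReal (μ := 0) (one_ne_zero (α := NNReal))
  refine continuous_iff_continuousAt.2 fun x => ?_
  rw [(monotone_cdf _).continuousAt_iff_leftLim_eq_rightLim, StieltjesFunction.rightLim_eq]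
  have h : (cdf (gaussianReal 0 1)).measure {x} = 0 := by
    rw [measure_cdf]; exact measure_singleton x
  rw [StieltjesFunction.measure_singleton, ENNReal.ofReal_eq_zero] at h
  exact le_antisymm ((monotone_cdf _).leftLim_le le_rfl) (by linarith)

/-- `Function.invFun` picks some preimage when one exists, so the intermediate value theorem
suffices; injectivity is not needed. -/
lemma qFunction_invFun {δ : ℝ} (h₀ : 0 < δ) (h₁ : δ < 1) :
    qFunction (Function.invFun qFunction δ) = δ := by
  refine Function.invFun_eq ?_
  have h := mem_range_of_exists_le_of_exists_ge continuous_cdf_gaussianReal (c := 1 - δ)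
    ((((tendsto_cdf_atBot (gaussianReal 0 1)).eventually_le_const (by linarith)).exists))
    ((((tendsto_cdf_atTop (gaussianReal 0 1)).eventually_const_le (by linarith)).exists))
  obtain ⟨x, hx⟩ := h
  exact ⟨x, by rw [qFunction_eq_one_sub_cdf, hx]; ring⟩

lemma kappa_pos {δ ε : ℝ} (hε : 0 < ε) : 0 < kappa δ ε := by
  unfold kappa
  set K := Function.invFun qFunction δ
  have h : |K| < Real.sqrt (K ^ 2 + 2 * ε) := by
    rw [← Real.sqrt_sq_eq_abs]
    exact Real.sqrt_lt_sqrt (sq_nonneg _) (by linarith)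
  have := neg_abs_le K
  exact mul_pos (by positivity) (by linarith)

/-- `κ` is the positive root of `2εκ² - 2Kκ - 1 = 0`. The left side is the threshold `ε/r - r/2` at
`r = 1/κ`. -/
lemma kappa_spec {δ ε : ℝ} (hε : 0 < ε) :
    ε * kappa δ ε - 1 / (2 * kappa δ ε) = Function.invFun qFunction δ := by
  have hk := kappa_pos (δ := δ) hε
  set K := Function.invFun qFunction δ with hK
  have hs : Real.sqrt (K ^ 2 + 2 * ε) ^ 2 = K ^ 2 + 2 * ε := Real.sq_sqrt (by positivity)
  have h2 : 2 * ε * kappa δ ε = K + Real.sqrt (K ^ 2 + 2 * ε) := by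
    unfold kappa; rw [← hK]; field_simp
  have h3 : 2 * ε * kappa δ ε ^ 2 - 2 * K * kappa δ ε - 1 = 0 := by
    have : (2 * ε * kappa δ ε - K) ^ 2 = K ^ 2 + 2 * ε := by
      rw [h2, add_sub_cancel_left, hs]
    have h4 : 2 * ε * (2 * ε * kappa δ ε ^ 2 - 2 * K * kappa δ ε - 1) = 0 := by linarith
    exact (mul_eq_zero.1 h4).resolve_left (by positivity)
  field_simp
  linarith

lemma pi_gaussianReal_map_sum {ι : Type*} [Fintype ι] (m : ι → ℝ) :
    (Measure.pi fun i => gaussianReal (m i) 1).map (fun x => ∑ i, m i * x i) =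
      gaussianReal (∑ i, m i ^ 2) (Real.toNNReal (∑ i, m i ^ 2)) := by
  have hind : iIndepFun (fun i (x : ι → ℝ) => m i * x i)
      (Measure.pi fun i => gaussianReal (m i) 1) :=
    iIndepFun_pi (X := fun i (y : ℝ) => m i * y) fun i => by fun_prop
  have h := map_sum_gaussianReal (m := fun i => m i ^ 2)
    (v := fun i => Real.toNNReal (m i ^ 2)) (fun i => by fun_prop) hind (fun i => ?_) Finset.univ
  · rw [Real.toNNReal_sum_of_nonneg fun i _ => sq_nonneg _, ← h]
    congr 1
    ext x
    simp
  · have h1 : (fun x : ι → ℝ => m i * x i) = (fun y => m i * y) ∘ Function.eval i := rfl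
    rw [h1, ← Measure.map_map (g := fun y => m i * y) (by fun_prop) (measurable_pi_apply i),
      (measurePreserving_eval _ i).map_eq, gaussianReal_map_const_mul]
    congr 1
    · ring
    · ext; simp [sq_nonneg]

lemma gaussianReal_sq_Ioi_le {δ ε r : ℝ} (hε : 0 < ε) (h₀ : 0 < δ) (h₁ : δ < 1) (hr : 0 ≤ r)
    (hrk : kappa δ ε * r ≤ 1) :
    gaussianReal (r ^ 2) (Real.toNNReal (r ^ 2)) (Set.Ioi (ε + r ^ 2 / 2)) ≤
      ENNReal.ofReal δ := by
  -- For `r = 0` the law is the Dirac mass at `0`, which misses the event because `ε > 0`.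
  rcases hr.eq_or_lt with rfl | hr
  · have : ¬ (ε < 0) := not_lt.2 hε.le
    simp [this]
  have hk := kappa_pos (δ := δ) hε
  have h : gaussianReal (r ^ 2) (Real.toNNReal (r ^ 2)) =
      (gaussianReal 0 1).map (fun x => r ^ 2 + r * x) := by
    have hc : (fun x => r ^ 2 + r * x) = (fun x => r ^ 2 + x) ∘ fun x => r * x := rfl
    rw [hc, ← Measure.map_map (by fun_prop) (by fun_prop), gaussianReal_map_const_mul,
      gaussianReal_map_const_add]
    congr 1
    · ring
    · ext; simp [sq_nonneg]
  have hset : (fun x => r ^ 2 + r * x) ⁻¹' Set.Ioi (ε + r ^ 2 / 2) =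
      Set.Ioi (ε / r - r / 2) := by
    ext x
    simp only [Set.mem_preimage, Set.mem_Ioi]
    rw [← mul_lt_mul_iff_right₀ hr (b := ε / r - r / 2)]
    have : r * (ε / r - r / 2) = ε - r ^ 2 / 2 := by field_simp
    rw [this]
    constructor <;> intro h <;> linarith
  rw [h, Measure.map_apply (by fun_prop) measurableSet_Ioi, hset, gaussianReal_Ioi]
  refine ENNReal.ofReal_le_ofReal ?_
  -- The threshold `ε/r - r/2` decreases in `r`, so for `r ≤ 1/κ` it is at least `K`.
  refine le_trans (antitone_qFunction ?_) (qFunction_invFun h₀ h₁).le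
  rw [← kappa_spec hε]
  have h1 : kappa δ ε ≤ 1 / r := by rw [le_div_iff₀ hr]; exact hrk
  have h2 : r ≤ 1 / kappa δ ε := by rw [le_div_iff₀ hk]; linarith
  have h3 : ε * kappa δ ε ≤ ε * (1 / r) := mul_le_mul_of_nonneg_left h1 hε.le
  have h4 : ε * (1 / r) = ε / r := by ring
  have h5 : 1 / (2 * kappa δ ε) = 1 / kappa δ ε / 2 := by field_simp
  linarith

/-- The Gaussian mechanism in finite dimension. -/
lemma pi_gaussianReal_le {ι : Type*} [Fintype ι] {δ ε : ℝ} (hε : 0 < ε) (h₀ : 0 < δ)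
    (h₁ : δ < 1) (m : ι → ℝ) (hm : kappa δ ε ^ 2 * ∑ i, m i ^ 2 ≤ 1) {S : Set (ι → ℝ)}
    (hS : MeasurableSet S) :
    Measure.pi (fun i => gaussianReal (m i) 1) S ≤
      ENNReal.ofReal (Real.exp ε) * Measure.pi (fun _ : ι => gaussianReal 0 1) S +
        ENNReal.ofReal δ := by
  have hk := kappa_pos (δ := δ) hε
  have hnn : 0 ≤ ∑ i, m i ^ 2 := Finset.sum_nonneg fun i _ => sq_nonneg _
  obtain ⟨r, hr, hr2⟩ : ∃ r, 0 ≤ r ∧ r ^ 2 = ∑ i, m i ^ 2 :=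
    ⟨_, Real.sqrt_nonneg _, Real.sq_sqrt hnn⟩
  have hrk : kappa δ ε * r ≤ 1 := by
    rw [← hr2, ← mul_pow] at hm
    exact (sq_le_one_iff₀ (by positivity)).1 hm
  have hl : Measurable fun x : ι → ℝ => ∑ i, m i * x i := by fun_prop
  -- `T` is where the likelihood ratio exceeds `e^ε`: off `T` the densities compare directly, and
  -- `T` itself costs at most `δ`.
  set T : Set (ι → ℝ) := (fun x => ∑ i, m i * x i) ⁻¹' Set.Ioi (ε + r ^ 2 / 2) with hT
  have hTm : MeasurableSet T := hl measurableSet_Ioi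
  calc Measure.pi (fun i => gaussianReal (m i) 1) S
      ≤ Measure.pi (fun i => gaussianReal (m i) 1) (S \ T) +
          Measure.pi (fun i => gaussianReal (m i) 1) T :=
        (measure_mono (by intro x hx; by_cases h : x ∈ T <;> simp [h, hx])).trans
          (measure_union_le _ _)
    _ ≤ _ := by
        refine add_le_add ?_ ?_
        · rw [pi_gaussianReal_eq_withDensity, withDensity_apply _ (hS.diff hTm)]
          refine (setLIntegral_mono (g := fun _ => ENNReal.ofReal (Real.exp ε))
            measurable_const fun x hx => ?_).trans ?_
          · refine ENNReal.ofReal_le_ofReal (Real.exp_le_exp.2 ?_)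
            have := hx.2
            simp only [hT, Set.mem_preimage, Set.mem_Ioi, not_lt] at this
            rw [← hr2]
            linarith
          · rw [setLIntegral_const]
            gcongr
            exact Set.sdiff_subset
        · rw [hT, ← Measure.map_apply hl measurableSet_Ioi, pi_gaussianReal_map_sum, ← hr2]
          exact gaussianReal_sq_Ioi_le hε h₀ h₁ hr hrk

/-- The Gaussian mechanism in countable dimension. -/
lemma infinitePi_gaussianReal_le {ι : Type*} {δ ε : ℝ} (hε : 0 < ε) (h₀ : 0 < δ)
    (h₁ : δ < 1) (m : ι → ℝ) (hm : ∀ s : Finset ι, kappa δ ε ^ 2 * ∑ i ∈ s, m i ^ 2 ≤ 1)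
    {S : Set (ι → ℝ)} (hS : MeasurableSet S) :
    Measure.infinitePi (fun i => gaussianReal (m i) 1) S ≤
      ENNReal.ofReal (Real.exp ε) * Measure.infinitePi (fun _ : ι => gaussianReal 0 1) S +
        ENNReal.ofReal δ := by
  set μ₁ := Measure.infinitePi (fun i => gaussianReal (m i) 1)
  set μ₀ := Measure.infinitePi (fun _ : ι => gaussianReal 0 1)
  have hcyl : ∀ t ∈ measurableCylinders (fun _ : ι => ℝ),
      μ₁ t ≤ ENNReal.ofReal (Real.exp ε) * μ₀ t + ENNReal.ofReal δ := by
    intro t ht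
    obtain ⟨s, U, hU, rfl⟩ := (mem_measurableCylinders t).1 ht
    rw [Measure.infinitePi_cylinder _ hU, Measure.infinitePi_cylinder _ hU]
    refine pi_gaussianReal_le hε h₀ h₁ _ ?_ hU
    rw [Finset.sum_coe_sort s fun i => m i ^ 2]
    exact hm s
  have hstep : ∀ η : NNReal, 0 < η → μ₁ S ≤
      (ENNReal.ofReal (Real.exp ε) * μ₀ S + ENNReal.ofReal δ) +
        (1 + ENNReal.ofReal (Real.exp ε)) * η := by
    intro η hη
    -- Approximating for the sum `μ₁ + μ₀` gives one cylinder that is good for both measures.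
    obtain ⟨t, ht, htS⟩ := exists_measure_symmDiff_lt_of_generateFrom_isSetRing
      (μ := μ₁ + μ₀) (isSetRing_measurableCylinders (α := fun _ : ι => ℝ))
      ⟨{Set.univ}, Set.countable_singleton _, by
        simpa using univ_mem_measurableCylinders (fun _ : ι => ℝ), by simp⟩
      generateFrom_measurableCylinders.symm hS (ENNReal.coe_pos.2 hη)
    rw [Measure.add_apply] at htS
    have h1 : μ₁ S ≤ μ₁ t + η := by
      refine (measure_mono (t := t ∪ symmDiff t S) ?_).trans ((measure_union_le _ _).trans ?_)
      · intro x hx; by_cases h : x ∈ t <;> simp [h, hx, Set.mem_symmDiff]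
      · exact add_le_add le_rfl (le_self_add.trans htS.le)
    have h2 : μ₀ t ≤ μ₀ S + η := by
      refine (measure_mono (t := S ∪ symmDiff t S) ?_).trans ((measure_union_le _ _).trans ?_)
      · intro x hx; by_cases h : x ∈ S <;> simp [h, hx, Set.mem_symmDiff]
      · exact add_le_add le_rfl (le_add_self.trans htS.le)
    calc μ₁ S ≤ μ₁ t + η := h1
      _ ≤ ENNReal.ofReal (Real.exp ε) * μ₀ t + ENNReal.ofReal δ + η := by
        gcongr; exact hcyl t ht
      _ ≤ ENNReal.ofReal (Real.exp ε) * (μ₀ S + η) + ENNReal.ofReal δ + η := by gcongr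
      _ = _ := by ring
  have hlim : Tendsto (fun η : NNReal => (ENNReal.ofReal (Real.exp ε) * μ₀ S + ENNReal.ofReal δ) +
        (1 + ENNReal.ofReal (Real.exp ε)) * (η : ℝ≥0∞)) (𝓝[>] 0)
      (𝓝 ((ENNReal.ofReal (Real.exp ε) * μ₀ S + ENNReal.ofReal δ) +
        (1 + ENNReal.ofReal (Real.exp ε)) * ((0 : NNReal) : ℝ≥0∞))) := by
    refine Tendsto.const_add _ (ENNReal.Tendsto.const_mul ?_ (Or.inr (by simp)))
    exact (ENNReal.tendsto_coe.2 tendsto_id).mono_left nhdsWithin_le_nhds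
  have := ge_of_tendsto hlim (eventually_nhdsWithin_of_forall fun η hη => hstep η hη)
  simpa using this

/-- The measure is the positive part of `μ₁ - μ₂`, carried by the Hahn set `E`; the hypothesis at
`E` itself bounds its mass. -/
lemma exists_measure_of_le_add {R : Type*} [MeasurableSpace R] (μ₁ μ₂ : Measure R)
    [IsFiniteMeasure μ₁] [IsFiniteMeasure μ₂] {δ : ℝ≥0∞}
    (h : ∀ S, MeasurableSet S → μ₁ S ≤ μ₂ S + δ) :
    ∃ μ : Measure R, μ Set.univ ≤ δ ∧ ∀ S, MeasurableSet S → μ₁ S ≤ μ₂ S + μ S := by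
  obtain ⟨E, hE, h1, h2⟩ := hahn_decomposition μ₁ μ₂
  refine ⟨(μ₁ - μ₂).restrict E, ?_, fun S hS => ?_⟩
  · rw [Measure.restrict_sub_eq_restrict_sub_restrict hE, Measure.sub_apply MeasurableSet.univ,
      Measure.restrict_apply_univ, Measure.restrict_apply_univ]
    · rw [tsub_le_iff_left]; exact h E hE
    · exact Measure.le_iff.2 fun s hs => by
        rw [Measure.restrict_apply hs, Measure.restrict_apply hs]
        exact h1 _ (hs.inter hE) Set.inter_subset_right
  · rw [Measure.restrict_sub_eq_restrict_sub_restrict hE, Measure.sub_apply hS,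
      Measure.restrict_apply hS, Measure.restrict_apply hS]
    · have h3 : μ₁ (S \ E) ≤ μ₂ (S \ E) :=
        h2 _ (hS.diff hE) fun x hx => hx.2
      calc μ₁ S = μ₁ (S \ E) + μ₁ (S ∩ E) := by rw [add_comm, measure_inter_add_sdiff _ hE]
        _ ≤ μ₂ (S \ E) + (μ₂ (S ∩ E) + (μ₁ (S ∩ E) - μ₂ (S ∩ E))) :=
          add_le_add h3 le_add_tsub
        _ = _ := by rw [← add_assoc, add_comm (μ₂ (S \ E)), measure_inter_add_sdiff _ hE]
    · exact Measure.le_iff.2 fun s hs => by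
        rw [Measure.restrict_apply hs, Measure.restrict_apply hs]
        exact h1 _ (hs.inter hE) Set.inter_subset_right

/-- By independence the joint law of `F` and `N` is a product, so the Gaussian bound holds for each
frozen value of `F` and is then integrated against a probability measure. -/
lemma measure_shift_le {Ω E R ι : Type*} [MeasurableSpace Ω] [MeasurableSpace E]
    [MeasurableSpace R] {Pr : Measure Ω} [IsProbabilityMeasure Pr] {δ ε : ℝ} (hε : 0 < ε)
    (h₀ : 0 < δ) (h₁ : δ < 1) {F : Ω → E} (hF : Measurable F) {N : ι → Ω → ℝ}
    (hN : ∀ i, Measurable (N i)) (hlaw : ∀ i, Pr.map (N i) = gaussianReal 0 1)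
    (hind : iIndepFun N Pr) (hNF : IndepFun (fun ω i => N i ω) F Pr)
    {g : E × (ι → ℝ) → R} (hg : Measurable g) (b : ι → ℝ)
    (hb : ∀ s : Finset ι, kappa δ ε ^ 2 * ∑ i ∈ s, b i ^ 2 ≤ 1) {S : Set R}
    (hS : MeasurableSet S) :
    Pr {ω | g (F ω, fun i => b i + N i ω) ∈ S} ≤
      ENNReal.ofReal (Real.exp ε) * Pr {ω | g (F ω, fun i => N i ω) ∈ S} +
        ENNReal.ofReal δ := by
  have hNm : Measurable fun ω i => N i ω := measurable_pi_iff.2 hN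
  have hlawN : Pr.map (fun ω i => N i ω) = Measure.infinitePi fun _ : ι => gaussianReal 0 1 := by
    rw [hind.map_fun_eq_infinitePi_map hN]
    simp_rw [hlaw]
  have hprod := (indepFun_iff_map_prod_eq_prod_map_map hF.aemeasurable hNm.aemeasurable).1
    hNF.symm
  have := Measure.isProbabilityMeasure_map (μ := Pr) hF.aemeasurable
  have hsh : Measurable fun z : ι → ℝ => fun i => b i + z i := by fun_prop
  have hgs : Measurable fun p : E × (ι → ℝ) => g (p.1, fun i => b i + p.2 i) :=
    hg.comp (measurable_fst.prodMk (hsh.comp measurable_snd))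
  have hrep : ∀ h : E × (ι → ℝ) → R, Measurable h → Pr {ω | h (F ω, fun i => N i ω) ∈ S} =
      ∫⁻ f, Measure.infinitePi (fun _ : ι => gaussianReal 0 1) {z | h (f, z) ∈ S}
        ∂(Pr.map F) := by
    intro h hh
    have h1 : {ω | h (F ω, fun i => N i ω) ∈ S} =
      (fun ω => (F ω, fun i => N i ω)) ⁻¹' (h ⁻¹' S) := rfl
    rw [h1, ← Measure.map_apply (hF.prodMk hNm) (hh hS), hprod, hlawN,
      Measure.prod_apply (hh hS)]
    rfl
  rw [hrep _ hg, hrep _ hgs, ← lintegral_const_mul' _ _ (by simp)]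
  calc _ ≤ ∫⁻ f, (ENNReal.ofReal (Real.exp ε) *
          Measure.infinitePi (fun _ : ι => gaussianReal 0 1) {z | g (f, z) ∈ S} +
            ENNReal.ofReal δ) ∂(Pr.map F) := by
        refine lintegral_mono fun f => ?_
        have hSf : MeasurableSet {z | g (f, z) ∈ S} := hg.comp measurable_prodMk_left hS
        have h2 := infinitePi_gaussianReal_le hε h₀ h₁ b hb hSf
        have h3 : Measure.infinitePi (fun i => gaussianReal (b i) 1) =
            (Measure.infinitePi fun _ : ι => gaussianReal 0 1).map
              (fun z i => b i + z i) := by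
          rw [Measure.infinitePi_map_pi (f := fun i y => b i + y) _ (fun i => by fun_prop)]
          simp_rw [gaussianReal_map_const_add, zero_add]
        rw [h3, Measure.map_apply hsh hSf] at h2
        exact h2
    _ = _ := by
        rw [lintegral_add_right _ measurable_const]
        simp

/-! ### Schur stability -/

section NormedMatrix

attribute [local instance] Matrix.linftyOpNormedRing Matrix.linftyOpNormedAlgebra

/-- Gelfand's formula, with `r` strictly between the spectral radius and `1`. It bounds large
powers; enlarging the constant covers the rest, which is possible since `r > 0`. -/
lemma exists_norm_pow_le_of_spectrum {A : Type*} [NormedRing A] [NormedAlgebra ℂ A]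
    [CompleteSpace A] [Nontrivial A] {a : A} (ha : ∀ z ∈ spectrum ℂ a, ‖z‖ < 1) :
    ∃ C r : ℝ, 0 ≤ C ∧ 0 ≤ r ∧ r < 1 ∧ ∀ k, ‖a ^ k‖ ≤ C * r ^ k := by
  have h1 : spectralRadius ℂ a < (1 : NNReal) :=
    spectrum.spectralRadius_lt_of_forall_lt a fun z hz => ha z hz
  obtain ⟨r, hr, hr1⟩ := ENNReal.lt_iff_exists_nnreal_btwn.1 h1
  have hr0 : (0 : ℝ) < r := by
    have : (0 : ℝ≥0∞) < r := lt_of_le_of_lt zero_le hr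
    exact_mod_cast this
  have hr1' : (r : ℝ) < 1 := by exact_mod_cast hr1
  have h2 := (spectrum.pow_nnnorm_pow_one_div_tendsto_nhds_spectralRadius a).eventually_lt_const hr
  have h3 : (fun k => a ^ k) =O[atTop] fun k => (r : ℝ) ^ k := by
    refine Asymptotics.IsBigO.of_bound 1 ?_
    filter_upwards [h2, eventually_gt_atTop 0] with k hk hk0
    have h4 : (‖a ^ k‖₊ : ℝ≥0∞) ≤ (r : ℝ≥0∞) ^ (k : ℝ) := by
      rw [← ENNReal.rpow_inv_le_iff (by exact_mod_cast hk0), ← one_div]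
      exact hk.le
    rw [ENNReal.rpow_natCast] at h4
    have h5 : ‖a ^ k‖ ≤ (r : ℝ) ^ k := by exact_mod_cast h4
    simpa [abs_of_pos hr0] using h5
  obtain ⟨C, hC, h6⟩ := Asymptotics.bound_of_isBigO_nat_atTop h3
  refine ⟨C, r, hC.le, hr0.le, hr1', fun k => ?_⟩
  have := h6 (x := k) (by positivity)
  simpa [abs_of_pos hr0] using this

lemma toComplex_eq_mapMatrix {k : ℕ} (A : Matrix (Fin k) (Fin k) ℝ) :
    toComplex A = Complex.ofRealHom.mapMatrix A := rfl

lemma IsSchur.exists_abs_pow_le {k : ℕ} {A : Matrix (Fin k) (Fin k) ℝ} (hA : IsSchur A) :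
    ∃ C r : ℝ, 0 ≤ C ∧ 0 ≤ r ∧ r < 1 ∧ ∀ t i j, |(A ^ t) i j| ≤ C * r ^ t := by
  -- Gelfand's bound is stated for a nontrivial algebra, so dimension zero is treated apart.
  rcases isEmpty_or_nonempty (Fin k) with hk | hk
  · exact ⟨0, 0, le_rfl, le_rfl, one_pos, fun t i => hk.elim i⟩
  obtain ⟨C, r, hC, hr, hr1, h⟩ := exists_norm_pow_le_of_spectrum hA
  refine ⟨C, r, hC, hr, hr1, fun t i j => le_trans ?_ (h t)⟩
  have h1 : toComplex A ^ t = toComplex (A ^ t) := by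
    rw [toComplex_eq_mapMatrix, toComplex_eq_mapMatrix, map_pow]
  rw [h1, Matrix.linfty_opNorm_def]
  have h2 : |(A ^ t) i j| = ‖toComplex (A ^ t) i j‖₊ := by
    simp [toComplex]
  rw [h2, NNReal.coe_le_coe]
  exact (Finset.single_le_sum (f := fun j => ‖toComplex (A ^ t) i j‖₊)
    (fun _ _ => zero_le) (Finset.mem_univ j)).trans
    (Finset.le_sup (f := fun i => ∑ j, ‖toComplex (A ^ t) i j‖₊) (Finset.mem_univ i))

end NormedMatrix

lemma IsSchur.tendsto_pow {k : ℕ} {A : Matrix (Fin k) (Fin k) ℝ} (hA : IsSchur A) :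
    Tendsto (fun t => A ^ t) atTop (𝓝 0) := by
  obtain ⟨C, r, -, hr, hr1, h⟩ := hA.exists_abs_pow_le
  refine tendsto_pi_nhds.2 fun i => tendsto_pi_nhds.2 fun j => ?_
  refine squeeze_zero_norm (fun t => h t i j) ?_
  simpa using (tendsto_pow_atTop_nhds_zero_of_lt_one hr hr1).const_mul C

lemma IsSchur.isUnit {k : ℕ} {A : Matrix (Fin k) (Fin k) ℝ} (hA : IsSchur A) {z : ℂ}
    (hz : ‖z‖ = 1) : IsUnit (z • (1 : Matrix (Fin k) (Fin k) ℂ) - toComplex A) := by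
  have h : z ∉ spectrum ℂ (toComplex A) := fun h => (hA z h).ne hz
  rwa [spectrum.notMem_iff, Algebra.algebraMap_eq_smul_one] at h

/-! ### The `H_∞` norm -/

lemma sigmaMax_nonneg {q l : ℕ} (M : Matrix (Fin q) (Fin l) ℂ) : 0 ≤ sigmaMax M := norm_nonneg _

lemma norm_mulVec_le_sigmaMax {q l : ℕ} (M : Matrix (Fin q) (Fin l) ℂ) (x : Fin l → ℂ) :
    ‖WithLp.toLp 2 (M *ᵥ x)‖ ≤ sigmaMax M * ‖WithLp.toLp 2 x‖ := by
  have := (Matrix.toEuclideanLin M).toContinuousLinearMap.le_opNorm (WithLp.toLp 2 x)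
  simpa [sigmaMax] using this

lemma continuous_sigmaMax {q l : ℕ} :
    Continuous (sigmaMax : Matrix (Fin q) (Fin l) ℂ → ℝ) := by
  let f : Matrix (Fin q) (Fin l) ℂ →ₗ[ℂ] (EuclideanSpace ℂ (Fin l) →L[ℂ] EuclideanSpace ℂ (Fin q)) :=
    (LinearMap.toContinuousLinearMap.toLinearMap).comp
      (Matrix.toEuclideanLin (𝕜 := ℂ) (m := Fin q) (n := Fin l)).toLinearMap
  exact (LinearMap.continuous_of_finiteDimensional f).norm

lemma norm_exp_mul_I (θ : ℝ) : ‖Complex.exp (θ * Complex.I)‖ = 1 :=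
  Complex.norm_exp_ofReal_mul_I θ

lemma continuous_transferFunction {k l q : ℕ} {F : Matrix (Fin k) (Fin k) ℝ} (hF : IsSchur F)
    (G : Matrix (Fin k) (Fin l) ℝ) (H : Matrix (Fin q) (Fin k) ℝ) (J : Matrix (Fin q) (Fin l) ℝ) :
    Continuous fun θ : ℝ => transferFunction F G H J (Complex.exp (θ * Complex.I)) := by
  have hinv : Continuous fun θ : ℝ =>
      (Complex.exp (θ * Complex.I) • (1 : Matrix (Fin k) (Fin k) ℂ) - toComplex F)⁻¹ := by
    refine continuous_iff_continuousAt.2 fun θ => ?_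
    have hu := (Matrix.isUnit_iff_isUnit_det _).1 (hF.isUnit (norm_exp_mul_I θ))
    refine ContinuousAt.comp (g := Inv.inv) (continuousAt_matrix_inv _ ?_) ?_
    · have h := NormedRing.inverse_continuousAt hu.unit
      rwa [IsUnit.unit_spec] at h
    · exact Continuous.continuousAt (by fun_prop)
  unfold transferFunction
  exact ((continuous_const.matrix_mul hinv).matrix_mul continuous_const).add continuous_const

lemma exists_sigmaMax_le {k l q : ℕ} {F : Matrix (Fin k) (Fin k) ℝ} (hF : IsSchur F)
    (G : Matrix (Fin k) (Fin l) ℝ) (H : Matrix (Fin q) (Fin k) ℝ) (J : Matrix (Fin q) (Fin l) ℝ) :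
    ∃ B, ∀ θ ∈ Set.Icc (-Real.pi) Real.pi,
      sigmaMax (transferFunction F G H J (Complex.exp (θ * Complex.I))) ≤ B := by
  obtain ⟨B, hB⟩ := (isCompact_Icc (a := -Real.pi) (b := Real.pi)).bddAbove_image
    (continuous_sigmaMax.comp (continuous_transferFunction hF G H J)).continuousOn
  exact ⟨B, fun θ hθ => hB (Set.mem_image_of_mem _ hθ)⟩

lemma hInfNorm_ne_top {k l q : ℕ} {F : Matrix (Fin k) (Fin k) ℝ} (hF : IsSchur F)
    (G : Matrix (Fin k) (Fin l) ℝ) (H : Matrix (Fin q) (Fin k) ℝ) (J : Matrix (Fin q) (Fin l) ℝ) :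
    hInfNorm (transferFunction F G H J) ≠ ⊤ := by
  obtain ⟨B, hB⟩ := exists_sigmaMax_le hF G H J
  refine ne_top_of_le_ne_top ENNReal.ofReal_ne_top (essSup_le_of_ae_le (ENNReal.ofReal B) ?_)
  filter_upwards [ae_restrict_mem measurableSet_Ico] with θ hθ
  exact ENNReal.ofReal_le_ofReal (hB θ (Set.Ico_subset_Icc_self hθ))

lemma ae_sigmaMax_le_hInfNorm {l q : ℕ} {G : ℂ → Matrix (Fin q) (Fin l) ℂ}
    (hG : hInfNorm G ≠ ⊤) :
    ∀ᵐ θ : ℝ ∂(volume.restrict (Set.Ioc (-Real.pi) Real.pi)),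
      sigmaMax (G (Complex.exp (θ * Complex.I))) ≤ (hInfNorm G).toReal := by
  rw [Measure.restrict_congr_set Ico_ae_eq_Ioc.symm]
  filter_upwards [ENNReal.ae_le_essSup
    (μ := volume.restrict (Set.Ico (-Real.pi) Real.pi))
    (fun θ : ℝ => ENNReal.ofReal (sigmaMax (G (Complex.exp (θ * Complex.I)))))] with θ hθ
  exact (ENNReal.ofReal_le_iff_le_toReal hG).1 hθ

/-- Entrywise complexification of a real vector. -/
noncomputable def complexify {k : ℕ} (x : Fin k → ℝ) : Fin k → ℂ := fun j => x j

lemma toComplex_mulVec {k l : ℕ} (M : Matrix (Fin k) (Fin l) ℝ) (x : Fin l → ℝ) :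
    toComplex M *ᵥ complexify x = complexify (M *ᵥ x) := by
  ext j
  simp [toComplex, complexify, Matrix.mulVec, dotProduct]

lemma complexify_add {k : ℕ} (x y : Fin k → ℝ) :
    complexify (x + y) = complexify x + complexify y := by
  ext j; simp [complexify]

/-- The Fourier transform at frequency `θ` of the first `T` samples of a signal. -/
noncomputable def fourierSum {k : ℕ} (a : ℕ → Fin k → ℝ) (T : ℕ) (θ : ℝ) : Fin k → ℂ :=
  ∑ t ∈ Finset.range T, (Complex.exp (θ * Complex.I))⁻¹ ^ t • complexify (a t)

lemma continuous_fourierSum {k : ℕ} (a : ℕ → Fin k → ℝ) (T : ℕ) :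
    Continuous (fourierSum a T) := by
  unfold fourierSum
  have h : Continuous fun θ : ℝ => (Complex.exp (θ * Complex.I))⁻¹ :=
    Continuous.inv₀ (by fun_prop) fun θ => Complex.exp_ne_zero _
  fun_prop

/-- In this real form Parseval's identity follows from the orthogonality of cosines. -/
lemma norm_sq_sum_exp (a : ℕ → ℝ) (T : ℕ) (θ : ℝ) :
    ‖∑ t ∈ Finset.range T, (Complex.exp (θ * Complex.I))⁻¹ ^ t * (a t : ℂ)‖ ^ 2 =
      ∑ s ∈ Finset.range T, ∑ t ∈ Finset.range T,
        a s * a t * Real.cos (((s : ℝ) - (t : ℝ)) * θ) := by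
  have h : ∑ t ∈ Finset.range T, (Complex.exp (θ * Complex.I))⁻¹ ^ t * (a t : ℂ) =
      ((∑ t ∈ Finset.range T, a t * Real.cos (t * θ) : ℝ) : ℂ) +
        ((- ∑ t ∈ Finset.range T, a t * Real.sin (t * θ) : ℝ) : ℂ) * Complex.I := by
    push_cast
    rw [neg_mul, Finset.sum_mul, ← sub_eq_add_neg, ← Finset.sum_sub_distrib]
    refine Finset.sum_congr rfl fun t _ => ?_
    rw [← Complex.exp_neg, ← Complex.exp_nat_mul,
      show (t : ℂ) * -(θ * Complex.I) = (-(t * θ)) * Complex.I by ring, Complex.exp_mul_I,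
      Complex.cos_neg, Complex.sin_neg]
    ring
  rw [h, Complex.sq_norm, Complex.normSq_add_mul_I, neg_sq, sq, sq, Finset.sum_mul_sum,
    Finset.sum_mul_sum, ← Finset.sum_add_distrib]
  refine Finset.sum_congr rfl fun s _ => ?_
  rw [← Finset.sum_add_distrib]
  refine Finset.sum_congr rfl fun t _ => ?_
  rw [sub_mul, Real.cos_sub]
  ring

lemma integral_cos_sub (s t : ℕ) :
    ∫ θ in (-Real.pi)..Real.pi, Real.cos (((s : ℝ) - (t : ℝ)) * θ) =
      if s = t then 2 * Real.pi else 0 := by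
  split_ifs with h
  · subst h; simp; ring
  · have hne : (s : ℝ) - t ≠ 0 := sub_ne_zero.2 (by exact_mod_cast h)
    rw [intervalIntegral.integral_comp_mul_left (f := Real.cos) hne, integral_cos, mul_neg,
      Real.sin_neg]
    have : Real.sin (((s : ℝ) - t) * Real.pi) = 0 := by
      simpa using Real.sin_int_mul_pi ((s : ℤ) - (t : ℤ))
    simp [this]

lemma integral_norm_sq_sum_exp (a : ℕ → ℝ) (T : ℕ) :
    ∫ θ in (-Real.pi)..Real.pi,
      ‖∑ t ∈ Finset.range T, (Complex.exp (θ * Complex.I))⁻¹ ^ t * (a t : ℂ)‖ ^ 2 =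
      2 * Real.pi * ∑ t ∈ Finset.range T, a t ^ 2 := by
  simp_rw [norm_sq_sum_exp]
  rw [intervalIntegral.integral_finsetSum fun s _ =>
    Continuous.intervalIntegrable (by fun_prop) _ _, Finset.mul_sum]
  refine Finset.sum_congr rfl fun s hs => ?_
  rw [intervalIntegral.integral_finsetSum fun t _ =>
    Continuous.intervalIntegrable (by fun_prop) _ _]
  simp_rw [intervalIntegral.integral_const_mul, integral_cos_sub]
  simp only [mul_ite, mul_zero, Finset.sum_ite_eq, hs, if_true]
  ring

/-- Parseval's identity for finitely supported signals. -/
lemma integral_norm_sq_fourierSum {k : ℕ} (a : ℕ → Fin k → ℝ) (T : ℕ) :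
    ∫ θ in (-Real.pi)..Real.pi, ‖WithLp.toLp 2 (fourierSum a T θ)‖ ^ 2 =
      2 * Real.pi * ∑ t ∈ Finset.range T, ∑ j, a t j ^ 2 := by
  have h : ∀ θ, ‖WithLp.toLp 2 (fourierSum a T θ)‖ ^ 2 =
      ∑ j, ‖∑ t ∈ Finset.range T, (Complex.exp (θ * Complex.I))⁻¹ ^ t * (a t j : ℂ)‖ ^ 2 := by
    intro θ
    rw [EuclideanSpace.norm_sq_eq]
    refine Finset.sum_congr rfl fun j _ => ?_
    simp [fourierSum, complexify]
  simp_rw [h]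
  have hc : Continuous fun θ : ℝ => (Complex.exp (θ * Complex.I))⁻¹ :=
    Continuous.inv₀ (by fun_prop) fun θ => Complex.exp_ne_zero _
  rw [intervalIntegral.integral_finsetSum fun s _ =>
    Continuous.intervalIntegrable (by fun_prop) _ _]
  simp_rw [integral_norm_sq_sum_exp]
  rw [← Finset.mul_sum, Finset.sum_comm]

/-- The state, started at `0`, of the linear system `ξ⁺ = F ξ + G u`. -/
noncomputable def systemState {k l : ℕ} (F : Matrix (Fin k) (Fin k) ℝ) (G : Matrix (Fin k) (Fin l) ℝ)
    (u : ℕ → Fin l → ℝ) : ℕ → Fin k → ℝ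
  | 0 => 0
  | t + 1 => F *ᵥ systemState F G u t + G *ᵥ u t

/-- The output `v = H ξ + J u` of the linear system `ξ⁺ = F ξ + G u` started at `0`. -/
noncomputable def systemOutput {k l q : ℕ} (F : Matrix (Fin k) (Fin k) ℝ) (G : Matrix (Fin k) (Fin l) ℝ)
    (H : Matrix (Fin q) (Fin k) ℝ) (J : Matrix (Fin q) (Fin l) ℝ) (u : ℕ → Fin l → ℝ) (t : ℕ) :
    Fin q → ℝ :=
  H *ᵥ systemState F G u t + J *ᵥ u t

/-! ### The `ℓ₂` gain of a stable linear system -/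

section System

variable {k l q : ℕ} (F : Matrix (Fin k) (Fin k) ℝ) (G : Matrix (Fin k) (Fin l) ℝ)
  (H : Matrix (Fin q) (Fin k) ℝ) (J : Matrix (Fin q) (Fin l) ℝ) (u : ℕ → Fin l → ℝ)

lemma systemState_congr {u u' : ℕ → Fin l → ℝ} {N : ℕ} (h : ∀ t < N, u t = u' t) :
    ∀ t ≤ N, systemState F G u t = systemState F G u' t
  | 0, _ => rfl
  | t + 1, ht => by
    rw [systemState, systemState, h t ht, systemState_congr h t (Nat.le_of_succ_le ht)]

lemma systemState_add {N : ℕ} (h : ∀ t, N ≤ t → u t = 0) (s : ℕ) :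
    systemState F G u (N + s) = (F ^ s) *ᵥ systemState F G u N := by
  induction s with
  | zero => simp
  | succ s ih =>
    rw [← add_assoc, systemState, ih, h _ (Nat.le_add_right _ _), Matrix.mulVec_zero, add_zero,
      Matrix.mulVec_mulVec, pow_succ']

lemma tendsto_systemState {F} (hF : IsSchur F) {N : ℕ} (h : ∀ t, N ≤ t → u t = 0) :
    Tendsto (systemState F G u) atTop (𝓝 0) := by
  rw [← tendsto_add_atTop_iff_nat N]
  simp_rw [add_comm _ N, systemState_add F G u h]
  have hc : Continuous fun M : Matrix (Fin k) (Fin k) ℝ => M *ᵥ systemState F G u N := by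
    fun_prop
  have ht := (hc.tendsto 0).comp hF.tendsto_pow
  rwa [Matrix.zero_mulVec] at ht

/-- Transforming the recursion on a finite window leaves a boundary term at time `T` only, because
the initial state is zero. -/
lemma fourierSum_systemState (T : ℕ) (θ : ℝ) :
    (Complex.exp (θ * Complex.I) • (1 : Matrix (Fin k) (Fin k) ℂ) - toComplex F) *ᵥ
        fourierSum (systemState F G u) T θ =
      toComplex G *ᵥ fourierSum u T θ -
        (Complex.exp (θ * Complex.I) * (Complex.exp (θ * Complex.I))⁻¹ ^ T) •
          complexify (systemState F G u T) := by
  have hz : Complex.exp (θ * Complex.I) ≠ 0 := Complex.exp_ne_zero _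
  induction T with
  | zero =>
    have : complexify (0 : Fin k → ℝ) = 0 := by ext; simp [complexify]
    simp [fourierSum, systemState, this]
  | succ T ih =>
    have hs : ∀ {m : ℕ} (a : ℕ → Fin m → ℝ), fourierSum a (T + 1) θ = fourierSum a T θ +
        (Complex.exp (θ * Complex.I))⁻¹ ^ T • complexify (a T) := fun a => by
      rw [fourierSum, Finset.sum_range_succ]; rfl
    rw [hs, hs, Matrix.mulVec_add, ih, Matrix.mulVec_add, systemState, complexify_add,
      Matrix.mulVec_smul, Matrix.mulVec_smul, Matrix.sub_mulVec, Matrix.smul_mulVec,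
      Matrix.one_mulVec, toComplex_mulVec, toComplex_mulVec, pow_succ']
    rw [mul_inv_cancel_left₀ hz, smul_sub, smul_add, smul_smul, mul_comm (Complex.exp _)]
    abel

lemma fourierSum_systemOutput {F} (hF : IsSchur F) (T : ℕ) (θ : ℝ) :
    fourierSum (systemOutput F G H J u) T θ =
      transferFunction F G H J (Complex.exp (θ * Complex.I)) *ᵥ fourierSum u T θ -
        transferFunction F 1 H 0 (Complex.exp (θ * Complex.I)) *ᵥ
          ((Complex.exp (θ * Complex.I) * (Complex.exp (θ * Complex.I))⁻¹ ^ T) •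
            complexify (systemState F G u T)) := by
  have hu := (Matrix.isUnit_iff_isUnit_det _).1 (hF.isUnit (norm_exp_mul_I θ))
  have h1 : fourierSum (systemOutput F G H J u) T θ =
      toComplex H *ᵥ fourierSum (systemState F G u) T θ + toComplex J *ᵥ fourierSum u T θ := by
    simp only [fourierSum, Matrix.mulVec_sum, Matrix.mulVec_smul, toComplex_mulVec,
      ← Finset.sum_add_distrib, ← smul_add, ← complexify_add, systemOutput]
  have h2 := congrArg (fun x => (Complex.exp (θ * Complex.I) • (1 : Matrix (Fin k) (Fin k) ℂ) -
    toComplex F)⁻¹ *ᵥ x) (fourierSum_systemState F G u T θ)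
  simp only [Matrix.mulVec_mulVec, Matrix.nonsing_inv_mul _ hu, Matrix.one_mulVec] at h2
  have h3 : toComplex (1 : Matrix (Fin k) (Fin k) ℝ) = 1 := by
    rw [toComplex_eq_mapMatrix, map_one]
  have h4 : toComplex (0 : Matrix (Fin q) (Fin k) ℝ) = 0 := by
    ext; simp [toComplex]
  rw [h1, h2, transferFunction, transferFunction, h3, h4, add_zero, Matrix.mul_one, Matrix.add_mulVec,
    Matrix.mulVec_sub, Matrix.mulVec_sub]
  simp only [Matrix.mulVec_mulVec, Matrix.mul_assoc]
  abel

/-- The horizon `T` is kept apart from the support `N` of the input. As `T` grows, the transform of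
the input stays fixed while the state at `T`, and with it the boundary term, tends to zero. -/
lemma sum_sq_systemOutput_le_of_eq_zero {F} (hF : IsSchur F) {N : ℕ}
    (h : ∀ t, N ≤ t → u t = 0) :
    ∑ t ∈ Finset.range N, ∑ j, systemOutput F G H J u t j ^ 2 ≤
      (hInfNorm (transferFunction F G H J)).toReal ^ 2 *
        ∑ t ∈ Finset.range N, ∑ j, u t j ^ 2 := by
  set γ := (hInfNorm (transferFunction F G H J)).toReal with hγ
  have hγ0 : 0 ≤ γ := ENNReal.toReal_nonneg
  -- `B` bounds `H (zI - F)⁻¹`, the operator applied to the boundary term, uniformly on the circle.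
  obtain ⟨B, hB⟩ := exists_sigmaMax_le hF (1 : Matrix (Fin k) (Fin k) ℝ) H 0
  have hcont : ∀ {m : ℕ} (a : ℕ → Fin m → ℝ) (T : ℕ),
      Continuous fun θ => ‖WithLp.toLp 2 (fourierSum a T θ)‖ := fun a T =>
    ((PiLp.continuous_toLp 2 _).comp (continuous_fourierSum a T)).norm
  have hcont2 : ∀ {m : ℕ} (a : ℕ → Fin m → ℝ) (T : ℕ),
      Continuous fun θ => ‖WithLp.toLp 2 (fourierSum a T θ)‖ ^ 2 := fun a T =>
    (hcont a T).pow 2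
  obtain ⟨M, hM⟩ := (isCompact_Icc (a := -Real.pi) (b := Real.pi)).bddAbove_image
    (hcont u N).continuousOn
  have hM' : ∀ θ ∈ Set.Icc (-Real.pi) Real.pi, ‖WithLp.toLp 2 (fourierSum u N θ)‖ ≤ M :=
    fun θ hθ => hM (Set.mem_image_of_mem _ hθ)
  have h0 : (0 : ℝ) ∈ Set.Icc (-Real.pi) Real.pi :=
    ⟨by linarith [Real.pi_pos], Real.pi_pos.le⟩
  have hM0 : 0 ≤ M := (norm_nonneg _).trans (hM' 0 h0)
  have hB0 : 0 ≤ B := (sigmaMax_nonneg _).trans (hB 0 h0)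
  set x : ℕ → ℝ := fun T => ‖WithLp.toLp 2 (complexify (systemState F G u T))‖ with hx
  have hxt : Tendsto x atTop (𝓝 0) := by
    have hc : Continuous fun v : Fin k → ℝ => ‖WithLp.toLp 2 (complexify v)‖ := by
      unfold complexify
      fun_prop
    have ht : Tendsto x atTop (𝓝 ‖WithLp.toLp 2 (complexify (0 : Fin k → ℝ))‖) :=
      (hc.tendsto 0).comp (tendsto_systemState G u hF h)
    have h0 : complexify (0 : Fin k → ℝ) = 0 := by ext; simp [complexify]
    rwa [h0, WithLp.toLp_zero, norm_zero] at ht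
  have hbound : ∀ T, N ≤ T → ∑ t ∈ Finset.range N, ∑ j, systemOutput F G H J u t j ^ 2 ≤
      γ ^ 2 * ∑ t ∈ Finset.range N, ∑ j, u t j ^ 2 + (2 * γ * M * B * x T + (B * x T) ^ 2) := by
    intro T hT
    have hU : ∀ θ, fourierSum u T θ = fourierSum u N θ := fun θ => by
      refine (Finset.sum_subset (Finset.range_mono hT) fun t _ ht => ?_).symm
      rw [h t (by simpa using ht)]
      have : complexify (0 : Fin l → ℝ) = 0 := by ext; simp [complexify]
      rw [this, smul_zero]
    have hpt : ∀ᵐ θ : ℝ ∂(volume.restrict (Set.Icc (-Real.pi) Real.pi)),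
        ‖WithLp.toLp 2 (fourierSum (systemOutput F G H J u) T θ)‖ ^ 2 ≤
          γ ^ 2 * ‖WithLp.toLp 2 (fourierSum u N θ)‖ ^ 2 +
            (2 * γ * M * B * x T + (B * x T) ^ 2) := by
      have hae := ae_sigmaMax_le_hInfNorm (hInfNorm_ne_top hF G H J)
      rw [Measure.restrict_congr_set Ioc_ae_eq_Icc] at hae
      filter_upwards [hae, ae_restrict_mem measurableSet_Icc] with θ h1 h2
      set y := ‖WithLp.toLp 2 (fourierSum u N θ)‖ with hy
      have hy0 : 0 ≤ y := norm_nonneg _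
      have hyM : y ≤ M := hM' θ h2
      have hx0 : 0 ≤ x T := norm_nonneg _
      have h3 : ‖WithLp.toLp 2 (fourierSum (systemOutput F G H J u) T θ)‖ ≤
          γ * y + B * x T := by
        rw [fourierSum_systemOutput G H J u hF, WithLp.toLp_sub]
        refine (norm_sub_le _ _).trans (add_le_add ?_ ?_)
        · rw [hU]
          exact (norm_mulVec_le_sigmaMax _ _).trans (mul_le_mul_of_nonneg_right h1 hy0)
        · refine (norm_mulVec_le_sigmaMax _ _).trans ?_
          rw [WithLp.toLp_smul, norm_smul, norm_mul, norm_pow, norm_inv, norm_exp_mul_I]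
          simp only [inv_one, one_pow, one_mul]
          exact mul_le_mul_of_nonneg_right (hB θ h2) hx0
      calc _ ≤ (γ * y + B * x T) ^ 2 := pow_le_pow_left₀ (norm_nonneg _) h3 2
        _ = γ ^ 2 * y ^ 2 + (2 * γ * y * B * x T + (B * x T) ^ 2) := by ring
        _ ≤ _ := by gcongr
    have hint := intervalIntegral.integral_mono_ae_restrict (μ := volume)
      (a := -Real.pi) (b := Real.pi) (by linarith [Real.pi_pos])
      ((hcont2 (systemOutput F G H J u) T).intervalIntegrable _ _)
      (Continuous.intervalIntegrable
        (((hcont2 u N).const_mul (γ ^ 2)).add_const _) _ _) hpt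
    rw [intervalIntegral.integral_add
        (((hcont2 u N).const_mul (γ ^ 2)).intervalIntegrable _ _)
        (continuous_const.intervalIntegrable _ _), intervalIntegral.integral_const_mul,
      integral_norm_sq_fourierSum, integral_norm_sq_fourierSum,
      intervalIntegral.integral_const, smul_eq_mul] at hint
    have h4 : ∑ t ∈ Finset.range N, ∑ j, systemOutput F G H J u t j ^ 2 ≤
        ∑ t ∈ Finset.range T, ∑ j, systemOutput F G H J u t j ^ 2 :=
      Finset.sum_le_sum_of_subset_of_nonneg (Finset.range_mono hT) fun t _ _ =>
        Finset.sum_nonneg fun j _ => sq_nonneg _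
    refine h4.trans (le_of_mul_le_mul_left (hint.trans_eq ?_) Real.two_pi_pos)
    ring
  have hlim : Tendsto (fun T => γ ^ 2 * ∑ t ∈ Finset.range N, ∑ j, u t j ^ 2 +
      (2 * γ * M * B * x T + (B * x T) ^ 2)) atTop
      (𝓝 (γ ^ 2 * ∑ t ∈ Finset.range N, ∑ j, u t j ^ 2 +
        (2 * γ * M * B * 0 + (B * 0) ^ 2))) :=
    ((hxt.const_mul _).add ((hxt.const_mul _).pow 2)).const_add _
  have := ge_of_tendsto hlim (eventually_atTop.2 ⟨N, hbound⟩)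
  simpa using this

/-- The `ℓ₂` gain of a stable system is at most the `H_∞` norm of its transfer function. -/
lemma sum_sq_systemOutput_le {F} (hF : IsSchur F) (N : ℕ) :
    ∑ t ∈ Finset.range N, ∑ j, systemOutput F G H J u t j ^ 2 ≤
      (hInfNorm (transferFunction F G H J)).toReal ^ 2 *
        ∑ t ∈ Finset.range N, ∑ j, u t j ^ 2 := by
  -- Causality: cutting the input off at time `N` does not change the first `N` outputs.
  have h := sum_sq_systemOutput_le_of_eq_zero G H J (fun t => if t < N then u t else 0) hF
    (N := N) (fun t ht => if_neg (not_lt.2 ht))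
  have hu : ∀ t < N, (if t < N then u t else 0) = u t := fun t ht => if_pos ht
  refine le_trans (le_of_eq ?_) (h.trans (le_of_eq ?_))
  · refine Finset.sum_congr rfl fun t ht => ?_
    have ht' := Finset.mem_range.1 ht
    rw [systemOutput, systemOutput, hu t ht', systemState_congr F G hu t ht'.le]
  · congr 1
    refine Finset.sum_congr rfl fun t ht => ?_
    rw [hu t (Finset.mem_range.1 ht)]

end System

/-! ### The algebraic Riccati equation -/

/-- The normal equations `h1`, `h2` for the optimal gain `K₀` absorb the cross terms into one
square, so any other gain `K` costs a positive semidefinite excess when `S` is positive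
semidefinite. -/
lemma riccati_completion_of_squares {d p : ℕ} {A V : Matrix (Fin d) (Fin d) ℝ}
    {C : Matrix (Fin p) (Fin d) ℝ} {K K₀ : Matrix (Fin d) (Fin p) ℝ}
    {R S : Matrix (Fin p) (Fin p) ℝ} (hS : S = C * V * Cᵀ + R)
    (h1 : A * V * Cᵀ = K₀ * S) (h2 : C * V * Aᵀ = S * K₀ᵀ) :
    (A - K * C) * V * (A - K * C)ᵀ + K * R * Kᵀ =
      A * V * Aᵀ - K₀ * S * K₀ᵀ + (K - K₀) * S * (K - K₀)ᵀ := by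
  have hR : R = S - C * V * Cᵀ := by rw [hS]; abel
  have h3 : A * V * Cᵀ * Kᵀ = K₀ * S * Kᵀ := by rw [h1]
  have h4 : K * (C * V * Aᵀ) = K * (S * K₀ᵀ) := by rw [h2]
  rw [hR]
  simp only [Matrix.mul_assoc] at h3 h4
  simp only [Matrix.transpose_sub, Matrix.transpose_mul, Matrix.mul_sub, Matrix.sub_mul,
    Matrix.mul_assoc, h3, h4]
  abel

lemma quadForm_conj {d p : ℕ} (K : Matrix (Fin d) (Fin p) ℝ) (S : Matrix (Fin p) (Fin p) ℝ)
    (x : Fin d → ℝ) : x ⬝ᵥ ((K * S * Kᵀ) *ᵥ x) = (x ᵥ* K) ⬝ᵥ (S *ᵥ (x ᵥ* K)) := by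
  rw [← Matrix.mulVec_mulVec, ← Matrix.mulVec_mulVec, Matrix.mulVec_transpose,
    Matrix.dotProduct_mulVec]

lemma posSemidef_conj {d p : ℕ} {S : Matrix (Fin p) (Fin p) ℝ} (hS : S.PosSemidef)
    (K : Matrix (Fin d) (Fin p) ℝ) : (K * S * Kᵀ).PosSemidef := by
  have := hS.mul_mul_conjTranspose_same K
  rwa [Matrix.conjTranspose_eq_transpose_of_trivial] at this

lemma posSemidef_self_mul_transpose {d p : ℕ} (B : Matrix (Fin d) (Fin p) ℝ) :
    (B * Bᵀ).PosSemidef := by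
  have := Matrix.posSemidef_self_mul_conjTranspose B
  rwa [Matrix.conjTranspose_eq_transpose_of_trivial] at this

lemma quadForm_nonneg {d : ℕ} {V : Matrix (Fin d) (Fin d) ℝ} (hV : V.PosSemidef)
    (x : Fin d → ℝ) : 0 ≤ x ⬝ᵥ (V *ᵥ x) := by
  simpa using hV.dotProduct_mulVec_nonneg x

lemma posSemidef_iff_isSymm_nonneg {d : ℕ} {V : Matrix (Fin d) (Fin d) ℝ} :
    V.PosSemidef ↔ Vᵀ = V ∧ ∀ x, 0 ≤ x ⬝ᵥ (V *ᵥ x) := by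
  constructor
  · intro h
    refine ⟨?_, quadForm_nonneg h⟩
    have := h.1
    rwa [Matrix.IsHermitian, Matrix.conjTranspose_eq_transpose_of_trivial] at this
  · rintro ⟨h1, h2⟩
    refine Matrix.PosSemidef.of_dotProduct_mulVec_nonneg ?_ (by simpa using h2)
    rwa [Matrix.IsHermitian, Matrix.conjTranspose_eq_transpose_of_trivial]

/-- A monotone sequence of symmetric matrices with bounded quadratic forms converges. -/
lemma exists_tendsto_of_monotone {d : ℕ} {V : ℕ → Matrix (Fin d) (Fin d) ℝ}
    (hs : ∀ k, (V k)ᵀ = V k) (hm : ∀ k, (V (k + 1) - V k).PosSemidef)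
    (hb : ∀ x, ∃ b, ∀ k, x ⬝ᵥ (V k *ᵥ x) ≤ b) : ∃ W, Tendsto V atTop (𝓝 W) := by
  have hq : ∀ x : Fin d → ℝ, ∃ l, Tendsto (fun k => x ⬝ᵥ (V k *ᵥ x)) atTop (𝓝 l) := by
    intro x
    obtain ⟨b, hb⟩ := hb x
    refine ⟨_, tendsto_atTop_ciSup (monotone_nat_of_le_succ fun k => ?_) ⟨b, ?_⟩⟩
    · have := quadForm_nonneg (hm k) x
      rw [Matrix.sub_mulVec, dotProduct_sub] at this
      linarith
    · rintro _ ⟨k, rfl⟩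
      exact hb k
  choose l hl using hq
  -- Polarization: the entries of a symmetric matrix are combinations of values of its quadratic
  -- form.
  have hpol : ∀ k i j, V k i j =
      ((Pi.single i 1 + Pi.single j 1 : Fin d → ℝ) ⬝ᵥ
          (V k *ᵥ (Pi.single i 1 + Pi.single j 1 : Fin d → ℝ)) -
        (Pi.single i 1 : Fin d → ℝ) ⬝ᵥ (V k *ᵥ (Pi.single i 1 : Fin d → ℝ)) -
        (Pi.single j 1 : Fin d → ℝ) ⬝ᵥ (V k *ᵥ (Pi.single j 1 : Fin d → ℝ))) / 2 := by
    intro k i j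
    have h : V k j i = V k i j := by
      conv_lhs => rw [← hs k]
      rfl
    simp [Matrix.mulVec_add, add_dotProduct, dotProduct_add, h]
    ring
  have hent : ∀ i j, ∃ w, Tendsto (fun k => V k i j) atTop (𝓝 w) := fun i j => by
    simp_rw [hpol]
    exact ⟨_, (((hl _).sub (hl _)).sub (hl _)).div_const 2⟩
  choose W hW using hent
  exact ⟨W, tendsto_pi_nhds.2 fun i => tendsto_pi_nhds.2 fun j => hW i j⟩

lemma posSemidef_of_tendsto {d : ℕ} {V : ℕ → Matrix (Fin d) (Fin d) ℝ}
    {W : Matrix (Fin d) (Fin d) ℝ} (hV : ∀ k, (V k).PosSemidef)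
    (h : Tendsto V atTop (𝓝 W)) : W.PosSemidef := by
  simp_rw [posSemidef_iff_isSymm_nonneg] at hV ⊢
  refine ⟨?_, fun x => ?_⟩
  · have h1 := (Continuous.matrix_transpose continuous_id).tendsto W |>.comp h
    refine tendsto_nhds_unique h1 (h.congr fun k => ((hV k).1).symm)
  · have hc : Continuous fun M : Matrix (Fin d) (Fin d) ℝ => x ⬝ᵥ (M *ᵥ x) := by
      fun_prop
    exact ge_of_tendsto' ((hc.tendsto W).comp h) fun k => (hV k).2 x

/-- The iterates of a stable Lyapunov recursion are bounded. -/
lemma IsSchur.exists_lyapunov_bound {d : ℕ} {F : Matrix (Fin d) (Fin d) ℝ} (hF : IsSchur F)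
    (Q : Matrix (Fin d) (Fin d) ℝ) :
    ∃ b, ∀ k i j, |(∑ t ∈ Finset.range k, F ^ t * Q * (F ^ t)ᵀ) i j| ≤ b := by
  obtain ⟨C, r, hC, hr, hr1, h⟩ := hF.exists_abs_pow_le
  refine ⟨C ^ 2 * (∑ a, ∑ b, |Q a b|) * (1 - r)⁻¹, fun k i j => ?_⟩
  have hq : 0 ≤ ∑ a, ∑ b, |Q a b| :=
    Finset.sum_nonneg fun a _ => Finset.sum_nonneg fun b _ => abs_nonneg _
  have hterm : ∀ t, |(F ^ t * Q * (F ^ t)ᵀ) i j| ≤ C ^ 2 * (∑ a, ∑ b, |Q a b|) * r ^ t := by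
    intro t
    -- The decay of one of the two powers of `F` already gives a geometric series; for the other, `r
    -- ^ t ≤ 1` is enough.
    have hrt : r ^ t ≤ 1 := pow_le_one₀ hr hr1.le
    have hrt0 : 0 ≤ r ^ t := pow_nonneg hr t
    simp only [Matrix.mul_apply, Matrix.transpose_apply, Finset.sum_mul]
    rw [Finset.sum_comm, Finset.mul_sum, Finset.sum_mul]
    refine (Finset.abs_sum_le_sum_abs _ _).trans (Finset.sum_le_sum fun a _ => ?_)
    rw [Finset.mul_sum, Finset.sum_mul]
    refine (Finset.abs_sum_le_sum_abs _ _).trans (Finset.sum_le_sum fun b _ => ?_)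
    rw [abs_mul, abs_mul]
    calc |(F ^ t) i a| * |Q a b| * |(F ^ t) j b|
        ≤ (C * r ^ t) * |Q a b| * (C * 1) := by
          gcongr
          · exact h t i a
          · exact (h t j b).trans (by gcongr)
      _ = C ^ 2 * |Q a b| * r ^ t := by ring
  rw [Matrix.sum_apply]
  calc _ ≤ ∑ t ∈ Finset.range k, C ^ 2 * (∑ a, ∑ b, |Q a b|) * r ^ t :=
        (Finset.abs_sum_le_sum_abs _ _).trans (Finset.sum_le_sum fun t _ => hterm t)
    _ = C ^ 2 * (∑ a, ∑ b, |Q a b|) * ∑ t ∈ Finset.range k, r ^ t :=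
        (Finset.mul_sum _ _ _).symm
    _ ≤ _ := by
        gcongr
        rw [← tsum_geometric_of_lt_one hr hr1]
        exact (summable_geometric_of_lt_one hr hr1).sum_le_tsum _ fun t _ => pow_nonneg hr t

lemma quadForm_le_of_entries_le {d : ℕ} {V : Matrix (Fin d) (Fin d) ℝ} {b : ℝ}
    (hb : ∀ i j, |V i j| ≤ b) (x : Fin d → ℝ) :
    x ⬝ᵥ (V *ᵥ x) ≤ ∑ i, ∑ j, |x i| * (b * |x j|) := by
  simp only [dotProduct, Matrix.mulVec, Finset.mul_sum]
  refine Finset.sum_le_sum fun i _ => Finset.sum_le_sum fun j _ => (le_abs_self _).trans ?_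
  rw [abs_mul, abs_mul]
  gcongr
  exact hb i j

/-- `a` and `b` are the real and imaginary parts of a left eigenvector, so that later arguments use
only real quadratic forms. -/
lemma mem_spectrum_toComplex_iff {d : ℕ} {F : Matrix (Fin d) (Fin d) ℝ} {z : ℂ} :
    z ∈ spectrum ℂ (toComplex F) ↔ ∃ a b : Fin d → ℝ, (a ≠ 0 ∨ b ≠ 0) ∧
      a ᵥ* F = z.re • a - z.im • b ∧ b ᵥ* F = z.im • a + z.re • b := by
  rw [spectrum.mem_iff, Algebra.algebraMap_eq_smul_one, Matrix.isUnit_iff_isUnit_det,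
    isUnit_iff_ne_zero, not_not, ← Matrix.exists_vecMul_eq_zero_iff]
  have key : ∀ v : Fin d → ℂ,
      (v ᵥ* (z • (1 : Matrix (Fin d) (Fin d) ℂ) - toComplex F) = 0 ↔
      (fun i => (v i).re) ᵥ* F = z.re • (fun i => (v i).re) - z.im • (fun i => (v i).im) ∧
      (fun i => (v i).im) ᵥ* F = z.im • (fun i => (v i).re) + z.re • (fun i => (v i).im)) := by
    intro v
    rw [Matrix.vecMul_sub, Matrix.vecMul_smul, Matrix.vecMul_one, sub_eq_zero, eq_comm,
      funext_iff, funext_iff, funext_iff, ← forall_and]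
    refine forall_congr' fun j => ?_
    rw [Complex.ext_iff]
    refine and_congr ?_ ?_
    · simp [Matrix.vecMul, dotProduct, toComplex]
    · simp [Matrix.vecMul, dotProduct, toComplex, add_comm]
  constructor
  · rintro ⟨v, hv0, hv⟩
    refine ⟨_, _, ?_, (key v).1 hv⟩
    by_contra hcon
    push Not at hcon
    refine hv0 (funext fun i => Complex.ext ?_ ?_)
    · exact congrFun hcon.1 i
    · exact congrFun hcon.2 i
  · rintro ⟨a, b, h0, hab⟩
    refine ⟨fun i => ⟨a i, b i⟩, fun h => ?_, (key _).2 hab⟩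
    rcases h0 with h0 | h0
    · exact h0 (funext fun i => congrArg Complex.re (congrFun h i))
    · exact h0 (funext fun i => congrArg Complex.im (congrFun h i))

/-- Iterating gives `X = F ^ k * X * (H ^ k)ᵀ`, which tends to zero. -/
lemma eq_zero_of_sylvester {d : ℕ} {F H X : Matrix (Fin d) (Fin d) ℝ} (hF : IsSchur F)
    (hH : IsSchur H) (h : X = F * X * Hᵀ) : X = 0 := by
  have hpow : ∀ k, F ^ k * X * (H ^ k)ᵀ = X := by
    intro k
    induction k with
    | zero => simp
    | succ k ih =>
      conv_rhs => rw [← ih]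
      rw [pow_succ, pow_succ, Matrix.transpose_mul]
      conv_rhs => rw [h]
      simp only [Matrix.mul_assoc]
  have hlim : Tendsto (fun k => F ^ k * X * (H ^ k)ᵀ) atTop (𝓝 (0 * X * 0)) := by
    have h2 : Tendsto (fun k => (H ^ k)ᵀ) atTop (𝓝 0) := by
      have hc : Continuous fun M : Matrix (Fin d) (Fin d) ℝ => Mᵀ := continuous_id.matrix_transpose
      have := hc.tendsto 0
      rw [Matrix.transpose_zero] at this
      exact this.comp hH.tendsto_pow
    exact (hF.tendsto_pow.mul_const X).mul h2
  simp_rw [hpow] at hlim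
  have h3 := tendsto_nhds_unique hlim tendsto_const_nhds
  rw [Matrix.zero_mul, Matrix.zero_mul] at h3
  exact h3.symm

/-! ### The Riccati recursion: existence, stability, uniqueness -/

namespace Participant

variable {q : ℕ} (P : Participant q)

lemma posDef_noiseCov (h : P.D.rank = P.p) : (P.D * P.Dᵀ).PosDef := by
  have hinj : Function.Injective P.D.vecMul := by
    rw [Matrix.vecMul_injective_iff, linearIndependent_iff_card_eq_finrank_span,
      Set.finrank, ← Matrix.rank_eq_finrank_span_row, h, Fintype.card_fin]
  have := Matrix.PosDef.mul_conjTranspose_self P.D hinj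
  rwa [Matrix.conjTranspose_eq_transpose_of_trivial] at this

variable {P} {V W : Matrix (Fin P.d) (Fin P.d) ℝ}

lemma posDef_innovationCov (hR : (P.D * P.Dᵀ).PosDef) (hV : V.PosSemidef) :
    (P.innovationCov V).PosDef :=
  (Matrix.PosDef.posSemidef_add (posSemidef_conj hV P.C) hR)

variable (P) in
/-- One step of the Riccati recursion. -/
noncomputable def riccati (V : Matrix (Fin P.d) (Fin P.d) ℝ) : Matrix (Fin P.d) (Fin P.d) ℝ :=
  P.A * V * P.Aᵀ - P.A * V * P.Cᵀ * (P.innovationCov V)⁻¹ * P.C * V * P.Aᵀ + P.B * P.Bᵀ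

variable (P) in
/-- The gain of the one-step predictor for the prediction error covariance `V`. -/
noncomputable def predictorGain (V : Matrix (Fin P.d) (Fin P.d) ℝ) :
    Matrix (Fin P.d) (Fin P.p) ℝ :=
  P.A * V * P.Cᵀ * (P.innovationCov V)⁻¹

variable (P) in
/-- The error covariance after one step of the predictor with gain `K`. -/
noncomputable def predictorCov (K : Matrix (Fin P.d) (Fin P.p) ℝ)
    (V : Matrix (Fin P.d) (Fin P.d) ℝ) : Matrix (Fin P.d) (Fin P.d) ℝ :=
  (P.A - K * P.C) * V * (P.A - K * P.C)ᵀ + (K * (P.D * P.Dᵀ) * Kᵀ + P.B * P.Bᵀ)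

lemma predictorGain_mul (hR : (P.D * P.Dᵀ).PosDef) (hV : V.PosSemidef) :
    P.A * V * P.Cᵀ = P.predictorGain V * P.innovationCov V := by
  rw [predictorGain, Matrix.nonsing_inv_mul_cancel_right]
  exact (Matrix.isUnit_iff_isUnit_det _).1 (posDef_innovationCov hR hV).isUnit

lemma mul_predictorGain_transpose (hR : (P.D * P.Dᵀ).PosDef) (hV : V.PosSemidef) :
    P.C * V * P.Aᵀ = P.innovationCov V * (P.predictorGain V)ᵀ := by
  have h := congrArg Matrix.transpose (predictorGain_mul hR hV)
  have h1 := (posSemidef_iff_isSymm_nonneg.1 hV).1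
  have h2 := (posSemidef_iff_isSymm_nonneg.1 (posDef_innovationCov hR hV).posSemidef).1
  simpa [Matrix.transpose_mul, h1, h2, Matrix.mul_assoc] using h

/-- The Riccati step is thus the minimum over all gains of the one-step error covariance; every
comparison below rests on this. -/
lemma predictorCov_eq (hR : (P.D * P.Dᵀ).PosDef) (hV : V.PosSemidef)
    (K : Matrix (Fin P.d) (Fin P.p) ℝ) :
    P.predictorCov K V = P.riccati V +
      (K - P.predictorGain V) * P.innovationCov V * (K - P.predictorGain V)ᵀ := by
  have h := riccati_completion_of_squares (K := K) (S := P.innovationCov V) rfl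
    (predictorGain_mul hR hV) (mul_predictorGain_transpose hR hV)
  have h1 : P.A * V * P.Cᵀ * (P.innovationCov V)⁻¹ * P.C * V * P.Aᵀ =
      P.predictorGain V * P.innovationCov V * (P.predictorGain V)ᵀ := by
    rw [Matrix.mul_assoc (P.predictorGain V), ← mul_predictorGain_transpose hR hV, predictorGain]
    simp only [Matrix.mul_assoc]
  rw [predictorCov, ← add_assoc, h, riccati, h1]
  abel

lemma riccati_eq (hR : (P.D * P.Dᵀ).PosDef) (hV : V.PosSemidef) :
    P.riccati V = P.predictorCov (P.predictorGain V) V := by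
  rw [predictorCov_eq hR hV]
  simp

lemma posSemidef_riccati (hR : (P.D * P.Dᵀ).PosDef) (hV : V.PosSemidef) :
    (P.riccati V).PosSemidef := by
  rw [riccati_eq hR hV]
  exact (posSemidef_conj hV _).add
    ((posSemidef_conj hR.posSemidef _).add (posSemidef_self_mul_transpose _))

lemma predictorCov_sub (K : Matrix (Fin P.d) (Fin P.p) ℝ) :
    P.predictorCov K W - P.predictorCov K V =
      (P.A - K * P.C) * (W - V) * (P.A - K * P.C)ᵀ := by
  simp only [predictorCov]
  generalize P.A - K * P.C = F
  rw [Matrix.mul_sub, Matrix.sub_mul]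
  abel

lemma posSemidef_predictorCov_sub_riccati (hR : (P.D * P.Dᵀ).PosDef) (hV : V.PosSemidef)
    (hVW : (W - V).PosSemidef) (K : Matrix (Fin P.d) (Fin P.p) ℝ) :
    (P.predictorCov K W - P.riccati V).PosSemidef := by
  have h : P.predictorCov K W - P.riccati V =
      (P.predictorCov K W - P.predictorCov K V) + (P.predictorCov K V - P.riccati V) := by abel
  rw [h, predictorCov_sub, predictorCov_eq hR hV K, add_sub_cancel_left]
  exact (posSemidef_conj hVW _).add
    (posSemidef_conj (posDef_innovationCov hR hV).posSemidef _)

/-- The optimal gain for `W` is merely admissible for `V`, and for a fixed gain the covariance is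
monotone. -/
lemma posSemidef_riccati_sub_riccati (hR : (P.D * P.Dᵀ).PosDef) (hV : V.PosSemidef)
    (hW : W.PosSemidef) (hVW : (W - V).PosSemidef) :
    (P.riccati W - P.riccati V).PosSemidef := by
  rw [riccati_eq hR hW]
  exact posSemidef_predictorCov_sub_riccati hR hV hVW _

lemma continuousAt_riccati (hR : (P.D * P.Dᵀ).PosDef) (hV : V.PosSemidef) :
    ContinuousAt P.riccati V := by
  have hu := (Matrix.isUnit_iff_isUnit_det _).1 (posDef_innovationCov hR hV).isUnit
  have hS : Continuous P.innovationCov := by unfold innovationCov; fun_prop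
  have hinv : ContinuousAt (fun V => (P.innovationCov V)⁻¹) V := by
    refine ContinuousAt.comp (g := Inv.inv) (continuousAt_matrix_inv _ ?_) hS.continuousAt
    have h := NormedRing.inverse_continuousAt hu.unit
    rwa [IsUnit.unit_spec] at h
  have hcomp : P.riccati = (fun p : Matrix (Fin P.d) (Fin P.d) ℝ × Matrix (Fin P.p) (Fin P.p) ℝ =>
      P.A * p.1 * P.Aᵀ - P.A * p.1 * P.Cᵀ * p.2 * P.C * p.1 * P.Aᵀ + P.B * P.Bᵀ) ∘
        fun V => (V, (P.innovationCov V)⁻¹) := rfl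
  rw [hcomp]
  exact ContinuousAt.comp (Continuous.continuousAt (by fun_prop)) (continuousAt_id.prodMk hinv)

variable (P) in
lemma exists_isSteadyStateCov (hR : (P.D * P.Dᵀ).PosDef) (hdet : P.Detectable) :
    ∃ V, P.IsSteadyStateCov V := by
  obtain ⟨G, hG⟩ := hdet
  set V : ℕ → Matrix (Fin P.d) (Fin P.d) ℝ := fun k => P.riccati^[k] 0 with hVdef
  have hsucc : ∀ k, V (k + 1) = P.riccati (V k) := fun k => Function.iterate_succ_apply' _ _ _
  have hpsd : ∀ k, (V k).PosSemidef := by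
    intro k
    induction k with
    | zero => exact Matrix.PosSemidef.zero
    | succ k ih => rw [hsucc]; exact posSemidef_riccati hR ih
  have hmono : ∀ k, (V (k + 1) - V k).PosSemidef := by
    intro k
    induction k with
    | zero => simpa [hVdef] using hpsd 1
    | succ k ih =>
      have h := posSemidef_riccati_sub_riccati hR (hpsd k) (hpsd (k + 1)) ih
      rwa [← hsucc, ← hsucc] at h
  set Q := G * (P.D * P.Dᵀ) * Gᵀ + P.B * P.Bᵀ with hQ
  set F := P.A - G * P.C with hF
  -- The covariances, from `0`, of the predictor with the fixed detectability gain `G`. They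
  -- dominate the optimal iterates and stay bounded because `F` is stable.
  set X : ℕ → Matrix (Fin P.d) (Fin P.d) ℝ :=
    fun k => ∑ t ∈ Finset.range k, F ^ t * Q * (F ^ t)ᵀ with hX
  have hXsucc : ∀ k, X (k + 1) = P.predictorCov G (X k) := by
    intro k
    simp only [hX]
    rw [Finset.sum_range_succ', predictorCov, Matrix.mul_sum, Matrix.sum_mul]
    simp only [pow_zero, Matrix.one_mul, Matrix.transpose_one, Matrix.mul_one, pow_succ',
      Matrix.transpose_mul, Matrix.mul_assoc, ← hF, hQ]
  have hle : ∀ k, (X k - V k).PosSemidef := by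
    intro k
    induction k with
    | zero => simpa [hVdef, hX] using Matrix.PosSemidef.zero
    | succ k ih =>
      rw [hsucc, hXsucc]
      exact posSemidef_predictorCov_sub_riccati hR (hpsd k) ih _
  obtain ⟨b, hb⟩ := hG.exists_lyapunov_bound Q
  obtain ⟨W, hW⟩ := exists_tendsto_of_monotone
    (fun k => (posSemidef_iff_isSymm_nonneg.1 (hpsd k)).1) hmono (fun x =>
      ⟨∑ i, ∑ j, |x i| * (b * |x j|), fun k => by
        have h1 := quadForm_nonneg (hle k) x
        rw [Matrix.sub_mulVec, dotProduct_sub] at h1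
        have h2 := quadForm_le_of_entries_le (hb k) x
        linarith⟩)
  have hWpsd := posSemidef_of_tendsto hpsd hW
  refine ⟨W, hWpsd, ?_⟩
  have h1 : Tendsto (fun k => V (k + 1)) atTop (𝓝 W) := (tendsto_add_atTop_iff_nat 1).2 hW
  have h2 : Tendsto (fun k => V (k + 1)) atTop (𝓝 (P.riccati W)) := by
    simp_rw [hsucc]
    exact (continuousAt_riccati hR hWpsd).tendsto.comp hW
  exact tendsto_nhds_unique h1 h2

/-- The predictor with the gain of a steady-state covariance is stable. -/
lemma IsSteadyStateCov.isSchur (hR : (P.D * P.Dᵀ).PosDef) (hstab : P.Stabilizable)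
    (hV : P.IsSteadyStateCov V) : IsSchur (P.A - P.predictorGain V * P.C) := by
  obtain ⟨L, hL⟩ := hstab
  intro z hz
  by_contra hcon
  obtain ⟨a, b, h0, ha, hb⟩ := mem_spectrum_toComplex_iff.1 hz
  have hVs := (posSemidef_iff_isSymm_nonneg.1 hV.1).1
  set K := P.predictorGain V with hK
  have hfix : V = P.predictorCov K V := hV.2.trans (riccati_eq hR hV.1)
  have hexp : ∀ x : Fin P.d → ℝ, x ⬝ᵥ (V *ᵥ x) =
      (x ᵥ* (P.A - K * P.C)) ⬝ᵥ (V *ᵥ (x ᵥ* (P.A - K * P.C))) +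
        ((x ᵥ* K) ⬝ᵥ ((P.D * P.Dᵀ) *ᵥ (x ᵥ* K)) + (x ᵥ* P.B) ⬝ᵥ (x ᵥ* P.B)) := by
    intro x
    conv_lhs => rw [hfix]
    have hB : P.B * P.Bᵀ = P.B * (1 : Matrix (Fin P.m) (Fin P.m) ℝ) * P.Bᵀ := by rw [Matrix.mul_one]
    rw [predictorCov, Matrix.add_mulVec, Matrix.add_mulVec, dotProduct_add, dotProduct_add,
      quadForm_conj, quadForm_conj, hB, quadForm_conj, Matrix.one_mulVec]
  have hcross : b ⬝ᵥ (V *ᵥ a) = a ⬝ᵥ (V *ᵥ b) := by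
    rw [Matrix.dotProduct_mulVec, ← Matrix.mulVec_transpose, hVs, dotProduct_comm]
  have hea := hexp a
  have heb := hexp b
  have hVa := quadForm_nonneg hV.1 a
  have hVb := quadForm_nonneg hV.1 b
  have hRa := quadForm_nonneg hR.posSemidef (a ᵥ* K)
  have hRb := quadForm_nonneg hR.posSemidef (b ᵥ* K)
  have hBa : 0 ≤ (a ᵥ* P.B) ⬝ᵥ (a ᵥ* P.B) := Finset.sum_nonneg fun _ _ => mul_self_nonneg _
  have hBb : 0 ≤ (b ᵥ* P.B) ⬝ᵥ (b ᵥ* P.B) := Finset.sum_nonneg fun _ _ => mul_self_nonneg _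
  have hz1 : 1 ≤ z.re ^ 2 + z.im ^ 2 := by
    have h1 : 1 ≤ ‖z‖ ^ 2 := one_le_pow₀ (not_lt.1 hcon)
    rw [Complex.sq_norm, Complex.normSq_apply] at h1
    linarith
  rw [ha] at hea
  rw [hb] at heb
  simp only [Matrix.mulVec_add, Matrix.mulVec_sub, Matrix.mulVec_smul, add_dotProduct,
    sub_dotProduct, dotProduct_add, dotProduct_sub, smul_dotProduct, dotProduct_smul,
    smul_eq_mul, hcross] at hea heb
  -- This is the Lyapunov identity for the Hermitian form at `a + ib`; the cross terms cancel on
  -- adding. If `|z| ≥ 1`, all summands are nonnegative, hence zero.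
  have hsum : (z.re ^ 2 + z.im ^ 2 - 1) * (a ⬝ᵥ (V *ᵥ a) + b ⬝ᵥ (V *ᵥ b)) +
      ((a ᵥ* K) ⬝ᵥ ((P.D * P.Dᵀ) *ᵥ (a ᵥ* K)) + (b ᵥ* K) ⬝ᵥ ((P.D * P.Dᵀ) *ᵥ (b ᵥ* K)) +
        (a ᵥ* P.B) ⬝ᵥ (a ᵥ* P.B) + (b ᵥ* P.B) ⬝ᵥ (b ᵥ* P.B)) = 0 := by
    linear_combination -hea - heb
  have hprod : 0 ≤ (z.re ^ 2 + z.im ^ 2 - 1) * (a ⬝ᵥ (V *ᵥ a) + b ⬝ᵥ (V *ᵥ b)) :=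
    mul_nonneg (by linarith) (by linarith)
  have hzero : ∀ x : Fin P.p → ℝ, x ⬝ᵥ ((P.D * P.Dᵀ) *ᵥ x) ≤ 0 → x = 0 := by
    intro x hx
    by_contra hne
    have := hR.dotProduct_mulVec_pos hne
    simp only [star_trivial] at this
    linarith
  have haK := hzero (a ᵥ* K) (by linarith)
  have hbK := hzero (b ᵥ* K) (by linarith)
  have haB : a ᵥ* P.B = 0 := dotProduct_self_eq_zero.1 (by linarith)
  have hbB : b ᵥ* P.B = 0 := dotProduct_self_eq_zero.1 (by linarith)
  -- Once `K` and `B` are annihilated, the closed loops `A - K C` and `A - B L` act alike on the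
  -- eigenvector, so `z` is an eigenvalue of the stable `A - B L`.
  have htransfer : ∀ x : Fin P.d → ℝ, x ᵥ* K = 0 → x ᵥ* P.B = 0 →
      x ᵥ* (P.A - P.B * L) = x ᵥ* (P.A - K * P.C) := by
    intro x h1 h2
    rw [Matrix.vecMul_sub, Matrix.vecMul_sub, ← Matrix.vecMul_vecMul, ← Matrix.vecMul_vecMul,
      h1, h2, Matrix.zero_vecMul, Matrix.zero_vecMul]
  exact hcon (hL z (mem_spectrum_toComplex_iff.2
    ⟨a, b, h0, by rw [htransfer a haK haB, ha], by rw [htransfer b hbK hbB, hb]⟩))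

/-- With the gain of `V` on the left and that of `W` on the right, the terms `K (D Dᵀ) Mᵀ` from the
two normal equations cancel, leaving a homogeneous equation. -/
lemma IsSteadyStateCov.sub_eq (hR : (P.D * P.Dᵀ).PosDef) (hV : P.IsSteadyStateCov V)
    (hW : P.IsSteadyStateCov W) :
    V - W = (P.A - P.predictorGain V * P.C) * (V - W) * (P.A - P.predictorGain W * P.C)ᵀ := by
  set K := P.predictorGain V with hK
  set M := P.predictorGain W with hM
  have h1 : P.A * V * P.Cᵀ = K * (P.C * V * P.Cᵀ + P.D * P.Dᵀ) := predictorGain_mul hR hV.1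
  have h2 : P.C * W * P.Aᵀ = (P.C * W * P.Cᵀ + P.D * P.Dᵀ) * Mᵀ :=
    mul_predictorGain_transpose hR hW.1
  have hVe : V = P.A * V * P.Aᵀ - K * (P.C * V * P.Aᵀ) + P.B * P.Bᵀ := by
    have h := hV.2
    rw [hK, predictorGain]
    simpa only [Matrix.mul_assoc] using h
  have hWe : W = P.A * W * P.Aᵀ - P.A * W * P.Cᵀ * Mᵀ + P.B * P.Bᵀ := by
    have h := hW.2
    have h3 : P.A * W * P.Cᵀ * (P.innovationCov W)⁻¹ * P.C * W * P.Aᵀ =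
        P.A * W * P.Cᵀ * Mᵀ := by
      have h4 := predictorGain_mul hR hW.1
      have h5 := mul_predictorGain_transpose hR hW.1
      have h6 : P.A * W * P.Cᵀ * (P.innovationCov W)⁻¹ * P.C * W * P.Aᵀ =
          M * (P.C * W * P.Aᵀ) := by
        rw [hM, predictorGain]; simp only [Matrix.mul_assoc]
      rw [h6, h5, h4, Matrix.mul_assoc]
    rwa [h3] at h
  have h1' : P.A * V * P.Cᵀ * Mᵀ = K * (P.C * V * P.Cᵀ + P.D * P.Dᵀ) * Mᵀ := by rw [h1]
  have h2' : K * (P.C * W * P.Aᵀ) = K * ((P.C * W * P.Cᵀ + P.D * P.Dᵀ) * Mᵀ) := by rw [h2]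
  simp only [Matrix.mul_assoc, Matrix.mul_add, Matrix.add_mul] at h1' h2' hVe hWe
  simp only [Matrix.transpose_sub, Matrix.transpose_mul, Matrix.mul_sub, Matrix.sub_mul,
    Matrix.mul_assoc, h1', h2']
  conv_lhs => rw [hVe, hWe]
  abel

lemma IsSteadyStateCov.unique (hR : (P.D * P.Dᵀ).PosDef) (hstab : P.Stabilizable)
    (hV : P.IsSteadyStateCov V) (hW : P.IsSteadyStateCov W) : V = W :=
  sub_eq_zero.1 (eq_zero_of_sylvester (hV.isSchur hR hstab) (hW.isSchur hR hstab)
    (hV.sub_eq hR hW))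

lemma isSteadyStateCov_steadyStateCov (h : ∃ V, P.IsSteadyStateCov V) :
    P.IsSteadyStateCov P.steadyStateCov := by
  rw [steadyStateCov, dif_pos h]
  exact h.choose_spec

lemma filterMatrix_eq : P.filterMatrix = P.A - P.predictorGain P.steadyStateCov * P.C := by
  rw [filterMatrix, gain, predictorGain]
  simp only [Matrix.mul_assoc]

end Participant

/-! ### The Kalman filter as a map: measurability and differences -/

namespace Participant

variable {q : ℕ} (P : Participant q)

lemma measurable_mulVec_comp {α : Type*} [MeasurableSpace α] {k l : ℕ}
    (M : Matrix (Fin k) (Fin l) ℝ) {f : α → Fin l → ℝ} (hf : Measurable f) :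
    Measurable fun a => M *ᵥ f a :=
  (Continuous.matrix_mulVec continuous_const continuous_id).measurable.comp hf

lemma measurable_prediction {α : Type*} [MeasurableSpace α] {y : α → ℕ → Fin P.p → ℝ}
    (hy : ∀ s, Measurable fun a => y a s) (t : ℕ) : Measurable fun a => P.prediction (y a) t := by
  induction t with
  | zero => exact measurable_const
  | succ t ih =>
    exact measurable_mulVec_comp _ (ih.add (measurable_mulVec_comp _
      ((hy t).sub (measurable_mulVec_comp _ ih))))

lemma measurable_kalmanFilter {α : Type*} [MeasurableSpace α] {y : α → ℕ → Fin P.p → ℝ}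
    (hy : ∀ s, Measurable fun a => y a s) (t : ℕ) :
    Measurable fun a => P.kalmanFilter (y a) t :=
  (P.measurable_prediction hy t).add (measurable_mulVec_comp _
    ((hy t).sub (measurable_mulVec_comp _ (P.measurable_prediction hy t))))

/-- Both filters start at `xbar`, so the difference starts at zero; `hu` allows the selection matrix
to be inserted in front of `u`. -/
lemma prediction_sub {S : Finset (Fin P.d)} {y y' : ℕ → Fin P.p → ℝ} {u : ℕ → Fin P.d → ℝ}
    (hy : ∀ s, y s - y' s = P.C *ᵥ u s) (hu : ∀ s, P.selection S *ᵥ u s = u s) (t : ℕ) :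
    P.prediction y t - P.prediction y' t =
      systemState P.filterMatrix (P.A * P.gain * (P.C * P.selection S)) u t := by
  induction t with
  | zero => simp [prediction, systemState]
  | succ t ih =>
    rw [systemState, ← ih, prediction, prediction, filterMatrix]
    simp only [← Matrix.mulVec_mulVec, hu, ← hy, Matrix.mulVec_add, Matrix.mulVec_sub,
      Matrix.sub_mulVec]
    abel

/-- Two outputs of the filter differ by the output of its noise-free part. -/
lemma kalmanFilter_sub {S : Finset (Fin P.d)} {y y' : ℕ → Fin P.p → ℝ} {u : ℕ → Fin P.d → ℝ}
    (hy : ∀ s, y s - y' s = P.C *ᵥ u s) (hu : ∀ s, P.selection S *ᵥ u s = u s) (t : ℕ) :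
    P.L *ᵥ P.kalmanFilter y t = P.L *ᵥ P.kalmanFilter y' t +
      systemOutput P.filterMatrix (P.A * P.gain * (P.C * P.selection S))
        (P.L * (1 - P.gain * P.C)) (P.L * P.gain * (P.C * P.selection S)) u t := by
  rw [systemOutput, ← P.prediction_sub hy hu, kalmanFilter, kalmanFilter]
  simp only [← Matrix.mulVec_mulVec, hu, ← hy, Matrix.mulVec_add, Matrix.mulVec_sub,
    Matrix.sub_mulVec, Matrix.one_mulVec]
  abel

variable {P}

lemma isSchur_filterMatrix (hrank : P.D.rank = P.p) (hdet : P.Detectable)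
    (hstab : P.Stabilizable) : IsSchur P.filterMatrix := by
  have hR := P.posDef_noiseCov hrank
  rw [filterMatrix_eq]
  exact (isSteadyStateCov_steadyStateCov (P.exists_isSteadyStateCov hR hdet)).isSchur hR hstab

lemma existsUnique_isSteadyStateCov (hrank : P.D.rank = P.p) (hdet : P.Detectable)
    (hstab : P.Stabilizable) : ∃! V, P.IsSteadyStateCov V := by
  have hR := P.posDef_noiseCov hrank
  obtain ⟨V, hV⟩ := P.exists_isSteadyStateCov hR hdet
  exact ⟨V, hV, fun W hW => hW.unique hR hstab hV⟩

end Participant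

lemma sum_sq_le_of_l2Norm_le {k : ℕ} {u : ℕ → Fin k → ℝ} {ρ : ℝ} (hρ : 0 ≤ ρ)
    (h : l2Norm u ≤ ENNReal.ofReal ρ) (N : ℕ) :
    ∑ t ∈ Finset.range N, ∑ j, u t j ^ 2 ≤ ρ ^ 2 := by
  have h1 : ∑' t, ∑ j, ‖u t j‖ₑ ^ 2 ≤ ENNReal.ofReal ρ ^ 2 := by
    rw [l2Norm, one_div, ENNReal.rpow_inv_le_iff (by norm_num)] at h
    exact_mod_cast h
  have h2 : ENNReal.ofReal (∑ t ∈ Finset.range N, ∑ j, u t j ^ 2) ≤ ENNReal.ofReal (ρ ^ 2) := by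
    rw [ENNReal.ofReal_pow hρ, ENNReal.ofReal_sum_of_nonneg fun t _ =>
      Finset.sum_nonneg fun j _ => sq_nonneg _]
    refine le_trans (le_of_eq ?_) ((ENNReal.sum_le_tsum (Finset.range N)).trans h1)
    refine Finset.sum_congr rfl fun t _ => ?_
    rw [ENNReal.ofReal_sum_of_nonneg fun j _ => sq_nonneg _]
    refine Finset.sum_congr rfl fun j _ => ?_
    rw [← sq_abs, ENNReal.ofReal_pow (abs_nonneg _), ← Real.enorm_eq_ofReal_abs]
  exact (ENNReal.ofReal_le_ofReal_iff (sq_nonneg _)).1 h2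

/-! ### Privacy of the output perturbation mechanism -/

section Mechanism

variable {n q : ℕ} {P : Fin n → Participant q} {S : (i : Fin n) → Finset (Fin (P i).d)}
  {ρ : Fin n → ℝ}

lemma le_noiseGain (i : Fin n) :
    (hInfNorm ((P i).filterTransfer (S i))).toReal * ρ i ≤ noiseGain P S ρ :=
  le_ciSup (f := fun i => (hInfNorm ((P i).filterTransfer (S i))).toReal * ρ i)
    (Set.finite_range _).bddAbove i

lemma noiseGain_nonneg (hρ : ∀ i, 0 ≤ ρ i) : 0 ≤ noiseGain P S ρ :=
  Real.iSup_nonneg fun i => mul_nonneg ENNReal.toReal_nonneg (hρ i)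

/-- The outputs for adjacent datasets differ by a deterministic signal whose `ℓ₂` norm is at most
the noise gain. -/
lemma Adjacent.exists_outputPerturbation_eq {Ω : Type*} (hF : ∀ i, IsSchur (P i).filterMatrix)
    (hρ : ∀ i, 0 ≤ ρ i) {x x' : Trajectories P} (h : Adjacent P S ρ x x')
    (w : (i : Fin n) → ℕ → Ω → Fin (P i).m → ℝ) (c : ℝ) (ν : ℕ → Ω → Fin q → ℝ) :
    ∃ v : ℕ → Fin q → ℝ,
      (∀ N, ∑ t ∈ Finset.range N, ∑ j, v t j ^ 2 ≤ noiseGain P S ρ ^ 2) ∧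
      ∀ ω t, outputPerturbation P w c ν x ω t = v t + outputPerturbation P w c ν x' ω t := by
  obtain ⟨i, h1, h2, h3⟩ := h
  set u : ℕ → Fin (P i).d → ℝ := fun t => x i t - x' i t with hu_def
  have hu : ∀ t, (P i).selection (S i) *ᵥ u t = u t := by
    intro t
    have := h2 t
    rw [← sub_eq_zero, ← Matrix.mulVec_sub, Matrix.sub_mulVec, Matrix.one_mulVec,
      sub_eq_zero] at this
    exact this.symm
  refine ⟨systemOutput (P i).filterMatrix
    ((P i).A * (P i).gain * ((P i).C * (P i).selection (S i)))
    ((P i).L * (1 - (P i).gain * (P i).C))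
    ((P i).L * (P i).gain * ((P i).C * (P i).selection (S i))) u, fun N => ?_, fun ω t => ?_⟩
  · refine (sum_sq_systemOutput_le _ _ _ u (hF i) N).trans ?_
    have hl : ∑ t ∈ Finset.range N, ∑ j, u t j ^ 2 ≤ ρ i ^ 2 := by
      refine sum_sq_le_of_l2Norm_le (hρ i) (le_trans (le_of_eq ?_) h1) N
      congr 1
      ext1 t
      rw [← Matrix.mulVec_sub]
      exact (hu t).symm
    refine (mul_le_mul_of_nonneg_left hl (sq_nonneg _)).trans ?_
    rw [← mul_pow]
    exact pow_le_pow_left₀ (mul_nonneg ENNReal.toReal_nonneg (hρ i)) (le_noiseGain i) 2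
  · have hy : ∀ s, ((P i).C *ᵥ x i s + (P i).D *ᵥ w i s ω) -
        ((P i).C *ᵥ x' i s + (P i).D *ᵥ w i s ω) = (P i).C *ᵥ u s := fun s => by
      rw [add_sub_add_right_eq_sub, Matrix.mulVec_sub]
    rw [outputPerturbation, outputPerturbation, ← add_assoc]
    congr 1
    rw [← Finset.add_sum_erase _ _ (Finset.mem_univ i),
      ← Finset.add_sum_erase Finset.univ (fun k => (P k).L *ᵥ (P k).kalmanFilter
        (fun s => (P k).C *ᵥ x' k s + (P k).D *ᵥ w k s ω) t) (Finset.mem_univ i),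
      (P i).kalmanFilter_sub hy hu, ← add_assoc, add_comm ((P i).L *ᵥ _)]
    congr 1
    refine Finset.sum_congr rfl fun k hk => ?_
    rw [h3 k (Finset.ne_of_mem_erase hk)]

lemma measurable_signal {α : Type*} [MeasurableSpace α] (x : Trajectories P)
    {w : (i : Fin n) → ℕ → α → Fin (P i).m → ℝ} (hw : ∀ i t, Measurable (w i t)) :
    Measurable fun a t => ∑ i, (P i).L *ᵥ (P i).kalmanFilter
      (fun s => (P i).C *ᵥ x i s + (P i).D *ᵥ w i s a) t := by
  refine measurable_pi_iff.2 fun t => Finset.measurable_sum _ fun i _ => ?_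
  exact Participant.measurable_mulVec_comp _ ((P i).measurable_kalmanFilter
    (fun s => measurable_const.add (Participant.measurable_mulVec_comp _ (hw i s))) t)

lemma measurable_outputPerturbation {Ω : Type*} [MeasurableSpace Ω] (x : Trajectories P)
    {w : (i : Fin n) → ℕ → Ω → Fin (P i).m → ℝ} (hw : ∀ i t, Measurable (w i t)) (c : ℝ)
    {ν : ℕ → Ω → Fin q → ℝ} (hν : ∀ t, Measurable (ν t)) :
    Measurable (outputPerturbation P w c ν x) := by
  refine measurable_pi_iff.2 fun t => ?_
  exact ((measurable_pi_apply t).comp (measurable_signal x hw)).add ((hν t).const_smul c)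

lemma prob_outputPerturbation_le {Ω : Type*} [MeasurableSpace Ω] {Pr : Measure Ω}
    [IsProbabilityMeasure Pr] (hF : ∀ i, IsSchur (P i).filterMatrix) (hρ : ∀ i, 0 ≤ ρ i)
    {ε δ : ℝ} (hε : 0 < ε) (hδ₀ : 0 < δ) (hδ₁ : δ < 1)
    {w : (i : Fin n) → ℕ → Ω → Fin (P i).m → ℝ} (hw : ∀ i t, Measurable (w i t))
    {ν : ℕ → Ω → Fin q → ℝ} (hν : IsStandardWhiteNoise Pr ν)
    (hindep : IndepFun (fun ω t => ν t ω) (fun ω i t => w i t ω) Pr)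
    {x x' : Trajectories P} (h : Adjacent P S ρ x x') {E : Set (ℕ → Fin q → ℝ)}
    (hE : MeasurableSet E) :
    Pr {ω | outputPerturbation P w (noiseGain P S ρ * kappa δ ε) ν x ω ∈ E} ≤
      ENNReal.ofReal (Real.exp ε) *
        Pr {ω | outputPerturbation P w (noiseGain P S ρ * kappa δ ε) ν x' ω ∈ E} +
      ENNReal.ofReal δ := by
  set γ := noiseGain P S ρ with hγ
  set c := γ * kappa δ ε with hc
  have hk := kappa_pos (δ := δ) hε
  obtain ⟨v, hv, hvx⟩ := h.exists_outputPerturbation_eq hF hρ w c ν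
  -- If `γ = 0` no noise is added, but then `v = 0` and the two releases coincide; otherwise `c > 0`
  -- and division by `c` is legitimate.
  rcases (noiseGain_nonneg (P := P) (S := S) hρ).eq_or_lt with h0 | hγpos
  · have hv0 : v = 0 := by
      funext t j
      have h1 := hv (t + 1)
      rw [← h0] at h1
      have h2 : v t j ^ 2 ≤ ∑ s ∈ Finset.range (t + 1), ∑ j, v s j ^ 2 :=
        (Finset.single_le_sum (f := fun j => v t j ^ 2) (fun _ _ => sq_nonneg _)
          (Finset.mem_univ j)).trans (Finset.single_le_sum (f := fun s => ∑ j, v s j ^ 2)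
          (fun _ _ => Finset.sum_nonneg fun _ _ => sq_nonneg _) (Finset.self_mem_range_succ t))
      have h3 : v t j ^ 2 = 0 := le_antisymm (by linarith) (sq_nonneg _)
      simpa using h3
    have hxx : ∀ ω, outputPerturbation P w c ν x ω = outputPerturbation P w c ν x' ω := fun ω => by
      funext t
      rw [hvx, hv0]
      simp
    simp_rw [hxx]
    refine le_add_right (le_mul_of_one_le_left' ?_)
    rw [← ENNReal.ofReal_one]
    exact ENNReal.ofReal_le_ofReal (Real.one_le_exp hε.le)
  have hcpos : 0 < c := mul_pos hγpos hk
  set F : Ω → ℕ → Fin q → ℝ := fun ω t => ∑ i, (P i).L *ᵥ (P i).kalmanFilter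
      (fun s => (P i).C *ᵥ x' i s + (P i).D *ᵥ w i s ω) t with hFdef
  set g : (ℕ → Fin q → ℝ) × (ℕ × Fin q → ℝ) → ℕ → Fin q → ℝ :=
    fun p t j => p.1 t j + c * p.2 (t, j) with hg
  have hgm : Measurable g := by
    refine measurable_pi_iff.2 fun t => measurable_pi_iff.2 fun j => ?_
    fun_prop
  have hφ : Measurable fun (z : ℕ → Fin q → ℝ) (s : ℕ × Fin q) => z s.1 s.2 := by fun_prop
  -- Taking the noise path itself as the variable shows that `F` is a measurable function of `w`, so
  -- it inherits independence from `ν`.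
  have hψ := measurable_signal (α := (i : Fin n) → ℕ → Fin (P i).m → ℝ) x'
    (w := fun i t W => W i t) (fun i t => by fun_prop)
  have hNF : IndepFun (fun ω (s : ℕ × Fin q) => ν s.1 ω s.2) F Pr := hindep.comp hφ hψ
  have hmain := measure_shift_le hε hδ₀ hδ₁ (F := F) (measurable_signal x' hw)
    (N := fun (s : ℕ × Fin q) ω => ν s.1 ω s.2)
    (fun s => (measurable_pi_apply s.2).comp (hν.1 s.1)) (fun s => hν.2.1 s.1 s.2) hν.2.2 hNF
    hgm (fun s => v s.1 s.2 / c) (fun s => ?_) hE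
  · have e1 : ∀ ω, g (F ω, fun s => v s.1 s.2 / c + ν s.1 ω s.2) =
        outputPerturbation P w c ν x ω := fun ω => by
      funext t j
      rw [hvx]
      simp only [hg, outputPerturbation, hFdef, Pi.add_apply, Pi.smul_apply, smul_eq_mul]
      field_simp
      ring
    have e2 : ∀ ω, g (F ω, fun s => ν s.1 ω s.2) = outputPerturbation P w c ν x' ω := fun ω => by
      funext t j
      simp only [hg, outputPerturbation, hFdef, Pi.add_apply, Pi.smul_apply, smul_eq_mul]
    simp_rw [e1, e2] at hmain
    exact hmain
  -- A finite index set lies in a time window, where the gain bound applies; then `κ² γ² / c² = 1`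
  -- since `c = γ κ`.
  · obtain ⟨N, hN⟩ : ∃ N, s ⊆ Finset.range N ×ˢ Finset.univ := by
      refine ⟨s.sup (fun p => p.1) + 1, fun p hp => ?_⟩
      simp only [Finset.mem_product, Finset.mem_range, Finset.mem_univ, and_true]
      exact Nat.lt_succ_of_le (Finset.le_sup (f := fun p : ℕ × Fin q => p.1) hp)
    have hs : ∑ p ∈ s, (v p.1 p.2 / c) ^ 2 ≤ γ ^ 2 / c ^ 2 := by
      calc ∑ p ∈ s, (v p.1 p.2 / c) ^ 2
          ≤ ∑ p ∈ Finset.range N ×ˢ Finset.univ, (v p.1 p.2 / c) ^ 2 :=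
            Finset.sum_le_sum_of_subset_of_nonneg hN fun _ _ _ => sq_nonneg _
        _ = (∑ t ∈ Finset.range N, ∑ j, v t j ^ 2) / c ^ 2 := by
            rw [Finset.sum_product]
            simp_rw [div_pow, Finset.sum_div]
        _ ≤ γ ^ 2 / c ^ 2 := by
            gcongr
            exact hv N
    calc kappa δ ε ^ 2 * ∑ p ∈ s, (v p.1 p.2 / c) ^ 2 ≤ kappa δ ε ^ 2 * (γ ^ 2 / c ^ 2) := by
          gcongr
      _ = 1 := by
          have hγ0 : γ ≠ 0 := hγpos.ne'
          rw [hc]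
          field_simp

end Mechanism

end PrivateKalman

theorem mainTheorem2 {n q : ℕ} {Ω : Type*} [MeasurableSpace Ω]
    (Pr : Measure Ω) [IsProbabilityMeasure Pr]
    (P : Fin n → PrivateKalman.Participant q)
    (hrank : ∀ i, (P i).D.rank = (P i).p)
    (hBD : ∀ i, (P i).B * (P i).Dᵀ = 0)
    (hdet : ∀ i, (P i).Detectable)
    (hstab : ∀ i, (P i).Stabilizable)
    (S : (i : Fin n) → Finset (Fin (P i).d))
    (ρ : Fin n → ℝ) (hρ : ∀ i, 0 ≤ ρ i)
    (ε δ : ℝ) (hε : 0 < ε) (hδ₀ : 0 < δ) (hδ₁ : δ < 1)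
    (w : (i : Fin n) → ℕ → Ω → Fin (P i).m → ℝ)
    (hw : ∀ i, PrivateKalman.IsStandardWhiteNoise Pr (w i))
    (ν : ℕ → Ω → Fin q → ℝ)
    (hν : PrivateKalman.IsStandardWhiteNoise Pr ν)
    (hindep : IndepFun (fun ω t => ν t ω) (fun ω i t => w i t ω) Pr) :
    (∀ i, (∃! V, (P i).IsSteadyStateCov V) ∧
      PrivateKalman.IsSchur (P i).filterMatrix ∧
      PrivateKalman.hInfNorm ((P i).filterTransfer (S i)) ≠ ⊤) ∧
    PrivateKalman.IsDifferentiallyPrivate (PrivateKalman.Adjacent P S ρ) Pr ε δ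
      (PrivateKalman.outputPerturbation P w
        (PrivateKalman.noiseGain P S ρ * PrivateKalman.kappa δ ε) ν) := by
  have hF : ∀ i, PrivateKalman.IsSchur (P i).filterMatrix := fun i =>
    PrivateKalman.Participant.isSchur_filterMatrix (hrank i) (hdet i) (hstab i)
  have hM := fun x => PrivateKalman.measurable_outputPerturbation (P := P) x
    (fun i => (hw i).1) (PrivateKalman.noiseGain P S ρ * PrivateKalman.kappa δ ε) hν.1
  refine ⟨fun i => ⟨PrivateKalman.Participant.existsUnique_isSteadyStateCov (hrank i) (hdet i)
    (hstab i), hF i, PrivateKalman.hInfNorm_ne_top (hF i) _ _ _⟩, hM, fun x x' hadj => ?_⟩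
  have hexp : ENNReal.ofReal (Real.exp ε) ≠ ⊤ := ENNReal.ofReal_ne_top
  have := Measure.smul_finite (Pr.map (PrivateKalman.outputPerturbation P w
    (PrivateKalman.noiseGain P S ρ * PrivateKalman.kappa δ ε) ν x')) hexp
  -- The factor `e^ε` is absorbed into the second law, which remains a finite measure.
  obtain ⟨μ, hμ, hle⟩ := PrivateKalman.exists_measure_of_le_add
    (Pr.map (PrivateKalman.outputPerturbation P w
      (PrivateKalman.noiseGain P S ρ * PrivateKalman.kappa δ ε) ν x))
    (ENNReal.ofReal (Real.exp ε) • Pr.map (PrivateKalman.outputPerturbation P w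
      (PrivateKalman.noiseGain P S ρ * PrivateKalman.kappa δ ε) ν x'))
    (δ := ENNReal.ofReal δ) (fun E hE => by
      rw [Measure.smul_apply, smul_eq_mul, Measure.map_apply (hM x) hE,
        Measure.map_apply (hM x') hE]
      exact PrivateKalman.prob_outputPerturbation_le hF hρ hε hδ₀ hδ₁ (fun i => (hw i).1) hν
        hindep hadj hE)
  refine ⟨μ, hμ, fun E hE => ?_⟩
  have h := hle E hE
  rw [Measure.smul_apply, smul_eq_mul, Measure.map_apply (hM x) hE,
    Measure.map_apply (hM x') hE] at h
  exact h
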